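/- All graphs are finite and simple. For an edge-coloring $c:E(G)\to\{1,\dots,k\}$ (not necessarily proper), the color-blind partition $c^*(v)$ of a vertex $v$ is the list $(a_1,\dots,a_k)$, where $a_i$ is the number of edges of color $i$ incident to $v$, rearranged in nonincreasing order. The coloring $c$ is color-blind distinguishing if $c^*(u)\neq c^*(v)$ for every edge $uv$, and $\operatorname{dal}(G)$ is the least $k$ for which $G$ has a color-blind distinguishing $k$-edge-coloring ($\operatorname{dal}(G)=\infty$ if there is none). A diamond consists of two distinct 3-cycles $xyz$ and $yzw$ sharing the edge $yz$ (the vertices $x$ and $w$ may be adjacent). A cycle of diamonds is a 3-regular graph in which every vertex is in a diamond; it is odd if it has $4t$ vertices with $t$ odd (so $K_4$ is an odd cycle of diamonds). (a) Let $G$ be a connected 3-regular graph in which every vertex lies on a 3-cycle. Then $G$ has a color-blind distinguishing edge-coloring (with some number of colors) if and only if $G$ is not an odd cycle of diamonds. When $G$ is not an odd cycle of diamonds, $\operatorname{dal}(G)\le 3$. (b) Let $G$ be a connected graph in which every vertex has degree 1 or 3, every vertex of degree 1 is adjacent to a vertex of degree 3, and every vertex of degree 3 lies on a 3-cycle. Then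 $G$ has a color-blind distinguishing 3-edge-coloring if and only if $G$ is not an odd cycle of diamonds. Moreover, when such a coloring exists, for every vertex $v$ of degree 3 adjacent to a vertex of degree 1 there are two color-blind distinguishing 3-edge-colorings $c_1,c_2$ of $G$ with $c_1^*(v)\ne c_2^*(v)$. -/

import Mathlib

namespace ColorBlind

/-- For an edge-coloring `c` with `k` colors, the number of edges incident to `v` of color `i`. -/
noncomputable def colorCount {V : Type*} {G : SimpleGraph V} {k : ℕ}
    (c : G.EdgeLabeling (Fin k)) (v : V) (i : Fin k) : ℕ :=
  Set.ncard {e : G.edgeSet | v ∈ (e : Sym2 V) ∧ c e = i}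

/-- The color-blind partition at `v`: the list `(a₁, …, a_k)` of the color counts at `v`,
reordered in nonincreasing order. -/
noncomputable def colorBlindPartition {V : Type*} {G : SimpleGraph V} {k : ℕ}
    (c : G.EdgeLabeling (Fin k)) (v : V) : List ℕ :=
  (Multiset.map (colorCount c v) (Finset.univ : Finset (Fin k)).val).sort (· ≥ ·)

/-- `c` is color-blind distinguishing: adjacent vertices have different color-blind partitions. -/
def IsColorBlindDistinguishing {V : Type*} {G : SimpleGraph V} {k : ℕ}
    (c : G.EdgeLabeling (Fin k)) : Prop :=
  ∀ u v : V, G.Adj u v → colorBlindPartition c u ≠ colorBlindPartition c v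

/-- `G` has a color-blind distinguishing edge-coloring with `k` colors (not all need be used). -/
def HasColorBlindColoring {V : Type*} (G : SimpleGraph V) (k : ℕ) : Prop :=
  ∃ c : G.EdgeLabeling (Fin k), IsColorBlindDistinguishing c

/-- The color-blind index of `G`: the least `k` such that `G` has a color-blind distinguishing
`k`-edge-coloring, and `⊤` if there is no such `k`. -/
noncomputable def dal {V : Type*} (G : SimpleGraph V) : ℕ∞ :=
  ⨅ (k : ℕ) (_ : HasColorBlindColoring G k), (k : ℕ∞)

/-- The vertex `v` lies on a 3-cycle of `G`. -/
def OnThreeCycle {V : Type*} (G : SimpleGraph V) (v : V) : Prop :=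
  ∃ a b : V, G.Adj v a ∧ G.Adj a b ∧ G.Adj b v

/-- `x, y, z, w` span a diamond: two different 3-cycles `xyz` and `yzw` sharing the edge `yz`.
The end vertices `x` and `w` may be adjacent (as they are in `K₄`). -/
def IsDiamond {V : Type*} (G : SimpleGraph V) (x y z w : V) : Prop :=
  x ≠ w ∧ G.Adj x y ∧ G.Adj x z ∧ G.Adj y z ∧ G.Adj y w ∧ G.Adj z w

/-- The vertex `v` lies in a diamond of `G`. -/
def InDiamond {V : Type*} (G : SimpleGraph V) (v : V) : Prop :=
  ∃ x y z w : V, IsDiamond G x y z w ∧ (v = x ∨ v = y ∨ v = z ∨ v = w)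

/-- A cycle of diamonds: a 3-regular graph in which every vertex is in a diamond. -/
def IsCycleOfDiamonds {V : Type*} [Fintype V] (G : SimpleGraph V) [DecidableRel G.Adj] : Prop :=
  G.IsRegularOfDegree 3 ∧ ∀ v : V, InDiamond G v

/-- An odd cycle of diamonds: a cycle of diamonds with `4t` vertices, `t` odd. -/
def IsOddCycleOfDiamonds {V : Type*} [Fintype V] (G : SimpleGraph V) [DecidableRel G.Adj] : Prop :=
  IsCycleOfDiamonds G ∧ ∃ t : ℕ, Odd t ∧ Fintype.card V = 4 * t

end ColorBlind

/-! The color-blind partition at a vertex of degree 3 is one of (3), (2,1), (1,1,1) up to zeros;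
call these types 0, 1, 2. A vertex of degree 1 always differs from its neighbor of degree 3, so a
distinguishing coloring amounts to a proper assignment of three types to the vertices of degree 3.
There is one further restriction: the end of a diamond cannot have type 0. The problem thus splits
into realizing type assignments by edge colorings and finding such assignments.

Realization (`IsFullTypeColoring.exists_edgeLabeling`): every triangle outside the diamonds, and
every diamond, has a unique vertex of type 0, its center. Give each center a color, to be used on
the outer edges at the type-2 vertices of its piece. Outside the diamonds, the edges inside a piece
can be filled in once the outer edges at its other vertices avoid this color. A triangle has just
one type-2 vertex, so this is a 3-coloring problem for the graph of a function; the colors of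
diamonds are chosen afterwards.

Existence (`exists_isTypeColoring`): give type 0 to one middle vertex of each diamond. Each
remaining vertex of degree 3 has a list of admissible types ({1,2} in a diamond, everything
elsewhere) at least as large as its remaining degree, and the remaining graph is connected. Greedy
coloring succeeds as soon as there is slack somewhere. A leaf, or one deleted outer edge, supplies
slack. With no leaves, there are three ways to restore the deleted edge. If there are no diamonds,
exchange types 0 and 1 along a chain. If a diamond meets a vertex outside the diamonds, use the
smaller list at the diamond. If all vertices are in diamonds, a conflict on the deleted edge forces
an odd number of diamonds by double counting.

Conversely, on a cycle of diamonds the same double count shows that a proper type assignment has an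
even number of type-0 vertices, one quarter of all vertices (`IsDiamondTypeColoring.even`). For the
last claim, the type at the neighbor of a leaf is changed by a chain exchange if it is 0, and by
exchanging 1 and 2 everywhere otherwise. -/

namespace ColorBlind

/-! ### Neighborhoods of vertices of degree 3. -/

section Neighborhoods

variable {V : Type*} {G : SimpleGraph V}

/-- The neighbors of `v` are the three distinct vertices `a`, `b`, `c`. -/
def NbrTriple (G : SimpleGraph V) (v a b c : V) : Prop :=
  a ≠ b ∧ a ≠ c ∧ b ≠ c ∧ ∀ u, G.Adj v u ↔ u = a ∨ u = b ∨ u = c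

theorem NbrTriple.rotate {v a b c : V} (h : NbrTriple G v a b c) : NbrTriple G v b c a := by
  obtain ⟨h1, h2, h3, h4⟩ := h
  exact ⟨h3, h1.symm, h2.symm, fun u => by rw [h4]; tauto⟩

theorem NbrTriple.swap {v a b c : V} (h : NbrTriple G v a b c) : NbrTriple G v b a c := by
  obtain ⟨h1, h2, h3, h4⟩ := h
  exact ⟨h1.symm, h3, h2, fun u => by rw [h4]; tauto⟩

theorem NbrTriple.adj₁ {v a b c : V} (h : NbrTriple G v a b c) : G.Adj v a :=
  (h.2.2.2 a).2 (Or.inl rfl)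

theorem NbrTriple.adj₂ {v a b c : V} (h : NbrTriple G v a b c) : G.Adj v b :=
  (h.2.2.2 b).2 (Or.inr (Or.inl rfl))

theorem NbrTriple.adj₃ {v a b c : V} (h : NbrTriple G v a b c) : G.Adj v c :=
  (h.2.2.2 c).2 (Or.inr (Or.inr rfl))

theorem NbrTriple.eq_or {v a b c u : V} (h : NbrTriple G v a b c) (hu : G.Adj v u) :
    u = a ∨ u = b ∨ u = c := (h.2.2.2 u).1 hu

variable [Fintype V] [DecidableRel G.Adj]

theorem NbrTriple.neighborFinset_eq [DecidableEq V] {v a b c : V} (h : NbrTriple G v a b c) :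
    G.neighborFinset v = {a, b, c} := by
  ext u; simp [h.2.2.2 u]

theorem NbrTriple.degree_eq {v a b c : V} (h : NbrTriple G v a b c) : G.degree v = 3 := by
  classical
  rw [← SimpleGraph.card_neighborFinset_eq_degree, h.neighborFinset_eq]
  exact Finset.card_eq_three.2 ⟨a, b, c, h.1, h.2.1, h.2.2.1, rfl⟩

theorem exists_nbrTriple_of_degree {v : V} (h : G.degree v = 3) : ∃ a b c, NbrTriple G v a b c := by
  classical
  rw [← SimpleGraph.card_neighborFinset_eq_degree, Finset.card_eq_three] at h
  obtain ⟨a, b, c, h1, h2, h3, h4⟩ := h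
  refine ⟨a, b, c, h1, h2, h3, fun u => ?_⟩
  rw [← SimpleGraph.mem_neighborFinset, h4]; simp

theorem exists_nbrTriple_of_adj {v a b : V} (h : G.degree v = 3) (ha : G.Adj v a) (hb : G.Adj v b)
    (hab : a ≠ b) : ∃ c, NbrTriple G v a b c := by
  obtain ⟨p, q, r, hv⟩ := exists_nbrTriple_of_degree h
  rcases hv.eq_or ha with rfl | rfl | rfl <;> rcases hv.eq_or hb with rfl | rfl | rfl
  · exact (hab rfl).elim
  · exact ⟨_, hv⟩
  · exact ⟨_, hv.rotate.swap.rotate.rotate⟩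
  · exact ⟨_, hv.swap⟩
  · exact (hab rfl).elim
  · exact ⟨_, hv.rotate⟩
  · exact ⟨_, hv.rotate.rotate⟩
  · exact ⟨_, hv.rotate.swap⟩
  · exact (hab rfl).elim

theorem nbrTriple_of_adj {v a b c : V} (h : G.degree v = 3) (ha : G.Adj v a) (hb : G.Adj v b)
    (hc : G.Adj v c) (hab : a ≠ b) (hac : a ≠ c) (hbc : b ≠ c) : NbrTriple G v a b c := by
  obtain ⟨d, hd⟩ := exists_nbrTriple_of_adj h ha hb hab
  rcases hd.eq_or hc with rfl | rfl | rfl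
  · exact (hac rfl).elim
  · exact (hbc rfl).elim
  · exact hd

end Neighborhoods

/-! ### Color-blind partitions expressed through the three types. -/

section Partitions

variable {V : Type*} {G : SimpleGraph V}

/-- The edge given by an adjacency. -/
def edgeOf {u v : V} (h : G.Adj u v) : G.edgeSet := ⟨s(u, v), (SimpleGraph.mem_edgeSet G).2 h⟩

theorem edgeOf_inj {v a b : V} (h : G.Adj v a) (h' : G.Adj v b) : edgeOf h = edgeOf h' ↔ a = b := by
  unfold edgeOf
  rw [Subtype.mk.injEq, Sym2.congr_right]

/-- The type of a vertex whose three edges have the colors `p`, `q`, `r`: `0` if all the colors are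
equal, `2` if they are distinct, and `1` otherwise. -/
def tripleType {α : Type*} [DecidableEq α] (p q r : α) : Fin 3 :=
  if p = q ∧ q = r then 0 else if p ≠ q ∧ q ≠ r ∧ p ≠ r then 2 else 1

open Classical in
/-- The type of a vertex for a function on the edges: `0` if its edges all have the same value,
`2` if their values are distinct, and `1` otherwise. -/
noncomputable def functionType {α : Type*} (c : G.edgeSet → α) (v : V) : Fin 3 :=
  open Classical in
  if ∀ e f : G.edgeSet, v ∈ (e : Sym2 V) → v ∈ (f : Sym2 V) → c e = c f then 0
  else if ∀ e f : G.edgeSet, v ∈ (e : Sym2 V) → v ∈ (f : Sym2 V) → c e = c f → e = f then 2 else 1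

/-- The type of a vertex for an edge coloring. -/
noncomputable def vertexType {α : Type*} (c : G.EdgeLabeling α) (v : V) : Fin 3 :=
  functionType (fun e => c e) v

theorem NbrTriple.mem_edge_iff {v a b d : V} (h : NbrTriple G v a b d) (e : G.edgeSet) :
    v ∈ (e : Sym2 V) ↔ e = edgeOf h.adj₁ ∨ e = edgeOf h.adj₂ ∨ e = edgeOf h.adj₃ := by
  obtain ⟨e, he⟩ := e
  constructor
  · intro hv
    obtain ⟨u, rfl⟩ := Sym2.mem_iff_exists.1 hv
    rcases h.eq_or ((SimpleGraph.mem_edgeSet G).1 he) with rfl | rfl | rfl <;> simp [edgeOf]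
  · unfold edgeOf
    rintro (h | h | h) <;> rw [Subtype.mk.injEq] at h <;> simp [h]

theorem NbrTriple.edge_ne {v a b d : V} (h : NbrTriple G v a b d) :
    edgeOf h.adj₁ ≠ (edgeOf h.adj₂) ∧
    edgeOf h.adj₁ ≠ (edgeOf h.adj₃) ∧
    edgeOf h.adj₂ ≠ (edgeOf h.adj₃) := by
  refine ⟨?_, ?_, ?_⟩ <;> rw [Ne, edgeOf_inj]
  exacts [h.1, h.2.1, h.2.2.1]

theorem NbrTriple.functionType_eq {α : Type*} [DecidableEq α] {v a b d : V}
    (h : NbrTriple G v a b d) (c : G.edgeSet → α) :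
    functionType c v = tripleType (c (edgeOf h.adj₁)) (c (edgeOf h.adj₂)) (c (edgeOf h.adj₃)) := by
  obtain ⟨h1, h2, h3⟩ := h.edge_ne
  unfold functionType tripleType
  have hm := h.mem_edge_iff
  generalize edgeOf h.adj₁ = x at *
  generalize edgeOf h.adj₂ = y at *
  generalize edgeOf h.adj₃ = z at *
  refine ite_congr (propext ?_) (fun _ => rfl) fun _ => ite_congr (propext ?_) (fun _ => rfl) fun _ => rfl
  · simp only [hm]
    constructor
    · intro H
      exact ⟨H _ _ (.inl rfl) (.inr (.inl rfl)), H _ _ (.inr (.inl rfl)) (.inr (.inr rfl))⟩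
    · rintro ⟨H1, H2⟩ e f (rfl | rfl | rfl) (rfl | rfl | rfl) <;> simp_all
  · simp only [hm]
    constructor
    · intro H
      exact ⟨fun h => h1 (H _ _ (.inl rfl) (.inr (.inl rfl)) h),
        fun h => h3 (H _ _ (.inr (.inl rfl)) (.inr (.inr rfl)) h),
        fun h => h2 (H _ _ (.inl rfl) (.inr (.inr rfl)) h)⟩
    · rintro ⟨H1, H2, H3⟩ e f (rfl | rfl | rfl) (rfl | rfl | rfl) H <;> simp_all

theorem NbrTriple.vertexType_eq {α : Type*} [DecidableEq α] {v a b d : V}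
    (h : NbrTriple G v a b d) (c : G.EdgeLabeling α) :
    vertexType c v = tripleType (c (edgeOf h.adj₁)) (c (edgeOf h.adj₂)) (c (edgeOf h.adj₃)) :=
  h.functionType_eq fun e => c e

theorem NbrTriple.colorCount_eq {k : ℕ} {v a b d : V} (h : NbrTriple G v a b d)
    (c : G.EdgeLabeling (Fin k)) (i : Fin k) :
    colorCount c v i = (if c (edgeOf h.adj₁) = i then 1 else 0) +
      ((if c (edgeOf h.adj₂) = i then 1 else 0) + (if c (edgeOf h.adj₃) = i then 1 else 0)) := by
  classical
  obtain ⟨h1, h2, h3⟩ := h.edge_ne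
  unfold colorCount
  simp only [h.mem_edge_iff]
  generalize edgeOf h.adj₁ = x at *
  generalize edgeOf h.adj₂ = y at *
  generalize edgeOf h.adj₃ = z at *
  have : {e : G.edgeSet | (e = x ∨ e = y ∨ e = z) ∧ c e = i} =
      ((({x, y, z} : Finset G.edgeSet).filter (fun e => c e = i) : Finset G.edgeSet) : Set _) := by
    ext e; simp
  rw [this, Set.ncard_coe_finset, Finset.card_filter, Finset.sum_insert (by simp [h1, h2]),
    Finset.sum_insert (by simp [h3]), Finset.sum_singleton]
  congr!

theorem colorBlindPartition_eq_iff {V' : Type*} {G' : SimpleGraph V'} {k : ℕ}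
    (c : G.EdgeLabeling (Fin k)) (c' : G'.EdgeLabeling (Fin k)) (u : V) (v : V') :
    colorBlindPartition c u = colorBlindPartition c' v ↔
      Multiset.map (colorCount c u) Finset.univ.val = Multiset.map (colorCount c' v) Finset.univ.val := by
  unfold colorBlindPartition
  constructor
  · intro h
    have := congrArg (fun l : List ℕ => (l : Multiset ℕ)) h
    simpa only [Multiset.sort_eq] using this
  · intro h; rw [h]

/-- The counting function of a triple of colors. -/
def tripleCount {k : ℕ} (p q r i : Fin k) : ℕ :=
  (if p = i then 1 else 0) + ((if q = i then 1 else 0) + (if r = i then 1 else 0))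

/-- Triples with the same equality pattern differ by a permutation of the colors, which only
reorders the counts. -/
theorem map_tripleCount_perm {k : ℕ} {p q r p' q' r' : Fin k} (h1 : p = q ↔ p' = q')
    (h2 : q = r ↔ q' = r') (h3 : p = r ↔ p' = r') :
    Multiset.map (tripleCount p q r) Finset.univ.val =
      Multiset.map (tripleCount p' q' r') Finset.univ.val := by
  obtain ⟨f, hf⟩ : ∃ f : Fin k → Fin k, f p = p' ∧ f q = q' ∧ f r = r' :=
    ⟨fun i => if i = p then p' else if i = q then q' else r', by
      refine ⟨by simp, ?_, ?_⟩
      · by_cases h : q = p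
        · simp [h, h1.1 h.symm]
        · simp [h]
      · by_cases h : r = p
        · simp [h, h3.1 h.symm]
        · by_cases h' : r = q
          · have := h2.1 h'.symm
            subst h'
            simp [h, this]
          · simp [h, h']⟩
  -- The partial map is injective on the colors that occur, so it extends to a permutation of all
  -- colors.
  obtain ⟨g, hg⟩ := Finset.exists_equiv_extend_of_card_eq (α := Fin k) (t := Finset.univ)
    (by simp) (s := {p, q, r}) (f := f) (by simp) (by
      obtain ⟨hp, hq, hr⟩ := hf
      intro x hx y hy hxy
      simp only [Finset.coe_insert, Finset.coe_singleton, Set.mem_insert_iff,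
        Set.mem_singleton_iff] at hx hy
      rcases hx with rfl | rfl | rfl <;> rcases hy with rfl | rfl | rfl <;> grind)
  let e : Fin k ≃ Fin k := g.trans (Equiv.subtypeUnivEquiv (by simp))
  have he : e p = p' ∧ e q = q' ∧ e r = r' := by
    refine ⟨?_, ?_, ?_⟩
    · rw [← hf.1]; exact hg p (by simp)
    · rw [← hf.2.1]; exact hg q (by simp)
    · rw [← hf.2.2]; exact hg r (by simp)
  have hcomp : tripleCount p q r = tripleCount p' q' r' ∘ e := by
    funext i
    simp only [tripleCount, Function.comp, ← he.1, ← he.2.1, ← he.2.2, e.injective.eq_iff]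
  rw [hcomp, ← Multiset.map_map]
  congr 1
  exact congrArg Finset.val (Finset.map_univ_equiv e)

theorem mem_map_tripleCount {k : ℕ} (p q r : Fin k) (n : ℕ) :
    n ∈ Multiset.map (tripleCount p q r) Finset.univ.val ↔ ∃ i, tripleCount p q r i = n := by
  simp

theorem three_mem_tripleCount {k : ℕ} (p q r : Fin k) :
    3 ∈ Multiset.map (tripleCount p q r) Finset.univ.val ↔ tripleType p q r = 0 := by
  rw [mem_map_tripleCount]
  constructor
  · rintro ⟨i, hi⟩
    unfold tripleCount at hi
    unfold tripleType
    split_ifs at hi <;> grind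
  · intro h
    have h0 : p = q ∧ q = r := by
      unfold tripleType at h
      grind
    exact ⟨p, by unfold tripleCount; grind⟩

theorem two_mem_tripleCount {k : ℕ} (p q r : Fin k) :
    2 ∈ Multiset.map (tripleCount p q r) Finset.univ.val ↔ tripleType p q r = 1 := by
  rw [mem_map_tripleCount]
  constructor
  · rintro ⟨i, hi⟩
    unfold tripleCount at hi
    unfold tripleType
    split_ifs at hi <;> grind
  · intro h
    by_cases h1 : p = q ∨ p = r
    · refine ⟨p, ?_⟩
      unfold tripleType at h
      unfold tripleCount
      grind
    · refine ⟨q, ?_⟩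
      unfold tripleType at h
      unfold tripleCount
      grind

theorem tripleCount_rotate {k : ℕ} (p q r : Fin k) : tripleCount p q r = tripleCount q r p := by
  funext i; unfold tripleCount; omega

/-- A count of 3 occurs exactly for type 0 and a count of 2 exactly for type 1, so the multiset of
counts determines the type. Conversely, the type fixes the equality pattern up to rotation of the
triple. -/
theorem map_tripleCount_eq_iff {k : ℕ} (p q r p' q' r' : Fin k) :
    Multiset.map (tripleCount p q r) Finset.univ.val =
      Multiset.map (tripleCount p' q' r') Finset.univ.val ↔
    tripleType p q r = tripleType p' q' r' := by
  constructor
  · intro h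
    have h3 := three_mem_tripleCount p q r
    have h3' := three_mem_tripleCount p' q' r'
    have h2 := two_mem_tripleCount p q r
    have h2' := two_mem_tripleCount p' q' r'
    rw [h] at h3 h2
    have e3 := h3.symm.trans h3'
    have e2 := h2.symm.trans h2'
    generalize tripleType p q r = s at *
    generalize tripleType p' q' r' = t at *
    fin_cases s <;> fin_cases t <;> simp_all
  · intro h
    -- Rotate so that, in type 1, the repeated color occupies the first two places; then equal types
    -- mean equal patterns.
    have key : ∀ p q r : Fin k, ∃ p₁ q₁ r₁, tripleCount p q r = tripleCount p₁ q₁ r₁ ∧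
        tripleType p q r = tripleType p₁ q₁ r₁ ∧
        (tripleType p₁ q₁ r₁ = 1 → p₁ = q₁) := by
      intro p q r
      by_cases h1 : p = q
      · exact ⟨p, q, r, rfl, rfl, fun _ => h1⟩
      by_cases h2 : q = r
      · exact ⟨q, r, p, tripleCount_rotate _ _ _, by unfold tripleType; grind, fun _ => h2⟩
      by_cases h3 : r = p
      · exact ⟨r, p, q, (tripleCount_rotate _ _ _).symm, by unfold tripleType; grind, fun _ => h3⟩
      · exact ⟨p, q, r, rfl, rfl, by unfold tripleType; grind⟩
    obtain ⟨p₁, q₁, r₁, ec, et, e1⟩ := key p q r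
    obtain ⟨p₂, q₂, r₂, ec', et', e1'⟩ := key p' q' r'
    rw [ec, ec']
    rw [et, et'] at h
    have : (p₁ = q₁ ↔ p₂ = q₂) ∧ (q₁ = r₁ ↔ q₂ = r₂) ∧ (p₁ = r₁ ↔ p₂ = r₂) := by
      unfold tripleType at h e1 e1'
      split_ifs at h e1 e1' <;> simp_all
    exact map_tripleCount_perm this.1 this.2.1 this.2.2

variable [Fintype V] [DecidableRel G.Adj]

theorem colorBlindPartition_eq_iff_vertexType {k : ℕ} (c c' : G.EdgeLabeling (Fin k)) {u v : V}
    (hu : G.degree u = 3) (hv : G.degree v = 3) :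
    colorBlindPartition c u = colorBlindPartition c' v ↔ vertexType c u = vertexType c' v := by
  obtain ⟨a, b, d, hu⟩ := exists_nbrTriple_of_degree hu
  obtain ⟨a', b', d', hv⟩ := exists_nbrTriple_of_degree hv
  rw [colorBlindPartition_eq_iff, hu.vertexType_eq, hv.vertexType_eq, ← map_tripleCount_eq_iff,
    funext (hu.colorCount_eq c), funext (hv.colorCount_eq c')]
  rfl

/-- The counts sum to 3 at a vertex of degree 3 and to at most 1 at a leaf. -/
theorem colorBlindPartition_ne_of_degree {k : ℕ} (c : G.EdgeLabeling (Fin k)) {u v : V}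
    (hu : G.degree u = 1) (hv : G.degree v = 3) :
    colorBlindPartition c u ≠ colorBlindPartition c v := by
  obtain ⟨a, b, d, hv⟩ := exists_nbrTriple_of_degree hv
  rw [Ne, colorBlindPartition_eq_iff]
  intro h
  have h := congrArg Multiset.sum h
  change ∑ i, colorCount c u i = ∑ i, colorCount c v i at h
  rw [Finset.sum_congr rfl (fun i _ => hv.colorCount_eq c i)] at h
  simp only [Finset.sum_add_distrib, Finset.sum_ite_eq, Finset.mem_univ, if_true] at h
  obtain ⟨w, hw⟩ : ∃ w, ∀ x, G.Adj u x ↔ x = w := by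
    rw [← SimpleGraph.card_neighborFinset_eq_degree, Finset.card_eq_one] at hu
    obtain ⟨w, hw⟩ := hu
    exact ⟨w, fun x => by rw [← SimpleGraph.mem_neighborFinset, hw]; simp⟩
  have hle : ∀ i, colorCount c u i ≤ if c (edgeOf ((hw w).2 rfl)) = i then 1 else 0 := by
    intro i
    have hsub : {e : G.edgeSet | u ∈ (e : Sym2 V) ∧ c e = i} ⊆ {edgeOf ((hw w).2 rfl)} := by
      rintro ⟨e, he⟩ ⟨h1, -⟩
      obtain ⟨x, rfl⟩ := Sym2.mem_iff_exists.1 h1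
      obtain rfl := (hw x).1 he
      rfl
    split_ifs with hi
    · exact (Set.ncard_le_ncard hsub).trans (by simp)
    · unfold colorCount
      rw [Nat.le_zero, Set.ncard_eq_zero (Set.toFinite _), Set.eq_empty_iff_forall_notMem]
      intro e he
      have := hsub he
      rw [Set.mem_singleton_iff] at this
      subst this
      exact hi he.2
  have := Finset.sum_le_sum (s := Finset.univ) (fun i _ => hle i)
  rw [h, Finset.sum_ite_eq] at this
  simp at this

end Partitions

end ColorBlind
namespace ColorBlind

/-! ### Triangles, diamonds, and inner and outer edges. -/

section Structure

variable {V : Type*} {G : SimpleGraph V}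

/-- `u` and `v` are adjacent and have a common neighbor. -/
def InnerAdj (G : SimpleGraph V) (u v : V) : Prop := G.Adj u v ∧ ∃ w, G.Adj u w ∧ G.Adj v w

/-- `u` and `v` are adjacent and have no common neighbor. -/
def OuterAdj (G : SimpleGraph V) (u v : V) : Prop := G.Adj u v ∧ ∀ w, G.Adj u w → ¬ G.Adj v w

theorem InnerAdj.symm {u v : V} (h : InnerAdj G u v) : InnerAdj G v u :=
  ⟨h.1.symm, h.2.imp fun _ h => h.symm⟩

theorem OuterAdj.symm {u v : V} (h : OuterAdj G u v) : OuterAdj G v u :=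
  ⟨h.1.symm, fun w h1 h2 => h.2 w h2 h1⟩

theorem InnerAdj.not_outerAdj {u v : V} (h : InnerAdj G u v) : ¬ OuterAdj G u v := by
  obtain ⟨_, w, h1, h2⟩ := h
  exact fun h' => h'.2 w h1 h2

theorem innerAdj_or_outerAdj {u v : V} (h : G.Adj u v) : InnerAdj G u v ∨ OuterAdj G u v := by
  by_cases h' : ∃ w, G.Adj u w ∧ G.Adj v w
  · exact .inl ⟨h, h'⟩
  · exact .inr ⟨h, fun w h1 h2 => h' ⟨w, h1, h2⟩⟩

theorem IsDiamond.symm {x y z w : V} (h : IsDiamond G x y z w) : IsDiamond G w y z x := by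
  obtain ⟨h1, h2, h3, h4, h5, h6⟩ := h
  exact ⟨h1.symm, h5.symm, h6.symm, h4, h2.symm, h3.symm⟩

theorem IsDiamond.swap {x y z w : V} (h : IsDiamond G x y z w) : IsDiamond G x z y w := by
  obtain ⟨h1, h2, h3, h4, h5, h6⟩ := h
  exact ⟨h1, h3, h2, h4.symm, h6, h5⟩

theorem IsDiamond.inDiamond₁ {x y z w : V} (h : IsDiamond G x y z w) : InDiamond G x :=
  ⟨x, y, z, w, h, .inl rfl⟩

theorem IsDiamond.inDiamond₂ {x y z w : V} (h : IsDiamond G x y z w) : InDiamond G y :=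
  ⟨x, y, z, w, h, .inr (.inl rfl)⟩

theorem IsDiamond.inDiamond₃ {x y z w : V} (h : IsDiamond G x y z w) : InDiamond G z :=
  h.swap.inDiamond₂

theorem IsDiamond.inDiamond₄ {x y z w : V} (h : IsDiamond G x y z w) : InDiamond G w :=
  h.symm.inDiamond₁

/-- A vertex in a diamond is an end or a middle vertex of a diamond. -/
theorem InDiamond.end_or_middle {v : V} (h : InDiamond G v) :
    (∃ y z w, IsDiamond G v y z w) ∨ ∃ x z w, IsDiamond G x v z w := by
  obtain ⟨x, y, z, w, h, rfl | rfl | rfl | rfl⟩ := h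
  exacts [.inl ⟨_, _, _, h⟩, .inr ⟨_, _, _, h⟩, .inr ⟨_, _, _, h.swap⟩, .inl ⟨_, _, _, h.symm⟩]

variable [Fintype V] [DecidableRel G.Adj]

/-- Graphs with vertices of degrees 1 and 3 in which the neighbors of vertices of degree 1 have
degree 3, and each vertex of degree 3 is on a 3-cycle. -/
structure IsTriangleLeafGraph (G : SimpleGraph V) [DecidableRel G.Adj] : Prop where
  deg : ∀ v, G.degree v = 1 ∨ G.degree v = 3
  leaf : ∀ u v, G.Adj u v → G.degree u = 1 → G.degree v = 3
  tri : ∀ v, G.degree v = 3 → OnThreeCycle G v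

namespace IsTriangleLeafGraph

variable (H : IsTriangleLeafGraph G)
include H

theorem degree_eq_three {v a b : V} (ha : G.Adj v a) (hb : G.Adj v b) (hab : a ≠ b) :
    G.degree v = 3 := by
  rcases H.deg v with h | h
  · rw [← SimpleGraph.card_neighborFinset_eq_degree, Finset.card_eq_one] at h
    obtain ⟨w, hw⟩ := h
    have ha' : a ∈ G.neighborFinset v := by simpa
    have hb' : b ∈ G.neighborFinset v := by simpa
    rw [hw, Finset.mem_singleton] at ha' hb'
    exact (hab (ha'.trans hb'.symm)).elim
  · exact h

theorem exists_nbrTriple {v a b : V} (ha : G.Adj v a) (hb : G.Adj v b) (hab : a ≠ b) :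
    ∃ c, NbrTriple G v a b c :=
  exists_nbrTriple_of_adj (H.degree_eq_three ha hb hab) ha hb hab

theorem degree_of_innerAdj {u v : V} (h : InnerAdj G u v) : G.degree u = 3 := by
  obtain ⟨h, w, h1, h2⟩ := h
  exact H.degree_eq_three h h1 h2.ne

theorem middle_triple {x y z w : V} (h : IsDiamond G x y z w) : NbrTriple G y x z w := by
  obtain ⟨h1, h2, h3, h4, h5, h6⟩ := h
  exact nbrTriple_of_adj (H.degree_eq_three h2.symm h5 h1) h2.symm h4 h5 h3.ne h1 h6.ne

theorem end_triple {x y z w : V} (h : IsDiamond G x y z w) : ∃ x', NbrTriple G x y z x' :=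
  H.exists_nbrTriple h.2.1 h.2.2.1 h.2.2.2.1.ne

theorem degree_of_inDiamond {v : V} (h : InDiamond G v) : G.degree v = 3 := by
  rcases h.end_or_middle with ⟨y, z, w, h⟩ | ⟨x, z, w, h⟩
  · exact H.degree_eq_three h.2.1 h.2.2.1 h.2.2.2.1.ne
  · exact (H.middle_triple h).degree_eq

/-- All neighbors of a middle vertex lie in its diamond. A triangle through an end uses a middle
vertex, whose neighbors are already known. Hence a triangle with one vertex in a diamond has all its
vertices in diamonds. -/
theorem inDiamond_of_innerAdj {u v : V} (hu : InDiamond G u) (huv : InnerAdj G u v) :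
    InDiamond G v := by
  rcases hu.end_or_middle with ⟨y, z, w, h⟩ | ⟨x, z, w, h⟩
  · obtain ⟨u', hu'⟩ := H.end_triple h
    obtain ⟨huv, t, h1, h2⟩ := huv
    rcases hu'.eq_or huv with rfl | rfl | rfl
    · exact h.inDiamond₂
    · exact h.inDiamond₃
    · rcases hu'.eq_or h1 with rfl | rfl | rfl
      · rcases (H.middle_triple h).eq_or h2.symm with rfl | rfl | rfl
        exacts [h.inDiamond₁, h.inDiamond₃, h.inDiamond₄]
      · rcases (H.middle_triple h.swap).eq_or h2.symm with rfl | rfl | rfl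
        exacts [h.inDiamond₁, h.inDiamond₂, h.inDiamond₄]
      · exact (h2.ne rfl).elim
  · rcases (H.middle_triple h).eq_or huv.1 with rfl | rfl | rfl
    exacts [h.inDiamond₁, h.inDiamond₃, h.inDiamond₄]

theorem exists_triangle {v : V} (h : G.degree v = 3) :
    ∃ a b c, NbrTriple G v a b c ∧ G.Adj a b := by
  obtain ⟨a, b, h1, h2, h3⟩ := H.tri v h
  obtain ⟨c, hc⟩ := exists_nbrTriple_of_adj h h1 h3.symm h2.ne
  exact ⟨a, b, c, hc, h2⟩

theorem exists_triangle_of_not_inDiamond {v : V} (h : G.degree v = 3) (hd : ¬ InDiamond G v) :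
    ∃ a b c, NbrTriple G v a b c ∧ G.Adj a b ∧ OuterAdj G v c := by
  obtain ⟨a, b, c, ht, hab⟩ := H.exists_triangle h
  refine ⟨a, b, c, ht, hab, ht.adj₃, fun w h1 h2 => hd ?_⟩
  rcases ht.eq_or h1 with rfl | rfl | rfl
  · exact (show IsDiamond G c v w b from
      ⟨ht.2.2.1.symm, ht.adj₃.symm, h2, ht.adj₁, ht.adj₂, hab⟩).inDiamond₂
  · exact (show IsDiamond G c v w a from
      ⟨ht.2.1.symm, ht.adj₃.symm, h2, ht.adj₂, ht.adj₁, hab.symm⟩).inDiamond₂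
  · exact (h2.ne rfl).elim

theorem middle_not_outerAdj {x y z w u : V} (h : IsDiamond G x y z w) : ¬ OuterAdj G y u := by
  intro hu
  rcases (H.middle_triple h).eq_or hu.1 with rfl | rfl | rfl
  · exact hu.2 _ h.2.2.2.1 h.2.2.1
  · exact hu.2 _ h.2.1.symm h.2.2.1.symm
  · exact hu.2 _ h.2.2.2.1 h.2.2.2.2.2.symm

theorem end_outerAdj {x y z w : V} (h : IsDiamond G x y z w) (hxw : ¬ G.Adj x w) :
    ∃ x', NbrTriple G x y z x' ∧ OuterAdj G x x' := by
  obtain ⟨x', hx⟩ := H.end_triple h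
  refine ⟨x', hx, hx.adj₃, fun t h1 h2 => ?_⟩
  rcases hx.eq_or h1 with rfl | rfl | rfl
  · rcases (H.middle_triple h).eq_or h2.symm with rfl | rfl | rfl
    exacts [hx.adj₃.ne rfl, hx.2.2.1 rfl, hxw hx.adj₃]
  · rcases (H.middle_triple h.swap).eq_or h2.symm with rfl | rfl | rfl
    exacts [hx.adj₃.ne rfl, hx.2.1 rfl, hxw hx.adj₃]
  · exact h2.ne rfl

theorem leaf_unique {v a b : V} (h : G.degree v = 1) (ha : G.Adj v a) (hb : G.Adj v b) : a = b := by
  by_contra hab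
  have := H.degree_eq_three ha hb hab
  omega

/-- A triangle takes two of the three edges at a vertex of degree 3, leaving at most one that can be
outer. -/
theorem outerAdj_unique {u v w : V} (hv : OuterAdj G u v) (hw : OuterAdj G u w) : v = w := by
  rcases H.deg u with h | h
  · exact H.leaf_unique h hv.1 hw.1
  · obtain ⟨a, b, c, ht, hab⟩ := H.exists_triangle h
    have key : ∀ x, OuterAdj G u x → x = c := by
      intro x hx
      rcases ht.eq_or hx.1 with rfl | rfl | rfl
      · exact (hx.2 b ht.adj₂ hab).elim
      · exact (hx.2 a ht.adj₁ hab.symm).elim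
      · rfl
    rw [key v hv, key w hw]

theorem outerAdj_of_leaf {u v : V} (h : G.degree u = 1) (huv : G.Adj u v) : OuterAdj G u v := by
  refine ⟨huv, fun w h1 h2 => ?_⟩
  rw [H.leaf_unique h h1 huv] at h2
  exact h2.ne rfl

/-- The inner neighbors of a vertex outside the diamonds are adjacent. -/
theorem innerAdj_adj {v a b : V} (hd : ¬ InDiamond G v) (ha : InnerAdj G v a) (hb : InnerAdj G v b)
    (hab : a ≠ b) : G.Adj a b := by
  obtain ⟨p, q, r, ht, hpq, ho⟩ :=
    H.exists_triangle_of_not_inDiamond (H.degree_of_innerAdj ha) hd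
  have key : ∀ x, InnerAdj G v x → x = p ∨ x = q := by
    intro x hx
    rcases ht.eq_or hx.1 with rfl | rfl | rfl
    · exact .inl rfl
    · exact .inr rfl
    · exact (hx.not_outerAdj ho).elim
  rcases key a ha with rfl | rfl <;> rcases key b hb with rfl | rfl
  exacts [(hab rfl).elim, hpq, hpq.symm, (hab rfl).elim]

end IsTriangleLeafGraph

/-! ### Type colorings. -/

/-- An assignment of types to the vertices that is proper on the vertices of degree 3, except perhaps
on the edges in `D`, and in which the ends of diamonds are not of type `0`. -/
structure IsTypeColoring (G : SimpleGraph V) [DecidableRel G.Adj] (D : Set (Sym2 V))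
    (τ : V → Fin 3) : Prop where
  proper : ∀ u v, G.degree u = 3 → G.degree v = 3 → G.Adj u v → s(u, v) ∉ D → τ u ≠ τ v
  diamond : ∀ x y z w, IsDiamond G x y z w → τ x ≠ 0

/-- An assignment of types to all vertices, proper on all edges. -/
structure IsFullTypeColoring (G : SimpleGraph V) [DecidableRel G.Adj] (τ : V → Fin 3) : Prop where
  proper : ∀ u v, G.Adj u v → τ u ≠ τ v
  diamond : ∀ x y z w, IsDiamond G x y z w → τ x ≠ 0
  leaf : ∀ v, G.degree v = 1 → τ v ≠ 0

/-- Of three types, one is left for a leaf after excluding 0 and the type of its only neighbor.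
Excluding 0 keeps leaves from being mistaken for centers. -/
theorem IsTypeColoring.exists_full (H : IsTriangleLeafGraph G) {τ : V → Fin 3}
    (h : IsTypeColoring G ∅ τ) :
    ∃ τ', IsFullTypeColoring G τ' ∧ ∀ v, G.degree v = 3 → τ' v = τ v := by
  classical
  have hval : ∀ v, ∃ t : Fin 3, (G.degree v = 3 → t = τ v) ∧
      (G.degree v = 1 → t ≠ 0 ∧ ∀ u, G.Adj v u → t ≠ τ u) := by
    intro v
    rcases H.deg v with hv | hv
    · have hv' := hv
      rw [← SimpleGraph.card_neighborFinset_eq_degree, Finset.card_eq_one] at hv'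
      obtain ⟨w, hw⟩ := hv'
      obtain ⟨t, h0, hw'⟩ : ∃ t : Fin 3, t ≠ 0 ∧ t ≠ τ w := by
        generalize τ w = s
        revert s; decide
      refine ⟨t, fun h => by omega, fun _ => ⟨h0, fun u hu => ?_⟩⟩
      have hu' : u ∈ G.neighborFinset v := by simpa
      rw [hw, Finset.mem_singleton] at hu'
      rwa [hu']
    · exact ⟨τ v, fun _ => rfl, fun h => by omega⟩
  choose τ' h3 h1 using hval
  refine ⟨τ', ⟨fun u v huv => ?_, fun x y z w hx => ?_, fun v hv => (h1 v hv).1⟩, h3⟩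
  · rcases H.deg u with hu | hu
    · rw [h3 v (H.leaf u v huv hu)]
      exact (h1 u hu).2 v huv
    · rcases H.deg v with hv | hv
      · rw [h3 u hu]
        exact ((h1 v hv).2 u huv.symm).symm
      · rw [h3 u hu, h3 v hv]
        exact h.proper u v hu hv huv (by simp)
  · rw [h3 x (H.degree_of_inDiamond hx.inDiamond₁)]
    exact h.diamond x y z w hx

end Structure

/-! ### Greedy list coloring. -/

section ListColoring

variable {Q C : Type*} [DecidableEq Q]

/-- Greedy list coloring of a degenerate set of vertices. -/
theorem exists_list_coloring (r : Q → Q → Prop) [DecidableRel r] (hr : ∀ p q, r p q → r q p)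
    (hirr : ∀ p, ¬ r p p)
    (L : Q → Finset C) [Inhabited C] (S : Finset Q)
    (h : ∀ T ⊆ S, T.Nonempty → ∃ q ∈ T, (T.filter (r q)).card < (L q).card) :
    ∃ c : Q → C, (∀ q ∈ S, c q ∈ L q) ∧ ∀ p ∈ S, ∀ q ∈ S, r p q → c p ≠ c q := by
  classical
  induction S using Finset.strongInduction with
  | H S ih =>
    by_cases hS : S.Nonempty
    · obtain ⟨q, hq, hlt⟩ := h S subset_rfl hS
      obtain ⟨c, hc1, hc2⟩ := ih (S.erase q) (Finset.erase_ssubset hq)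
        (fun T hT => h T (hT.trans (Finset.erase_subset _ _)))
      obtain ⟨x, hx, hx'⟩ : ∃ x ∈ L q, x ∉ (S.filter (r q)).image c := by
        by_contra! hcon
        exact absurd (Finset.card_le_card hcon) (not_le.2 (Finset.card_image_le.trans_lt hlt))
      have hne : ∀ p ∈ S, r q p → x ≠ c p := by
        rintro p hp hqp rfl
        exact hx' (Finset.mem_image_of_mem c (Finset.mem_filter.2 ⟨hp, hqp⟩))
      refine ⟨Function.update c q x, fun p hp => ?_, fun p hp p' hp' hpp => ?_⟩
      · by_cases hpq : p = q
        · subst hpq; simpa using hx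
        · rw [Function.update_of_ne hpq]
          exact hc1 p (Finset.mem_erase.2 ⟨hpq, hp⟩)
      · by_cases hpq : p = q
        · subst hpq
          have hpq' : p' ≠ p := fun h => hirr p (by rwa [h] at hpp)
          rw [Function.update_self, Function.update_of_ne hpq']
          exact hne p' hp' hpp
        · by_cases hpq' : p' = q
          · subst hpq'
            rw [Function.update_self, Function.update_of_ne hpq]
            exact (hne p hp (hr _ _ hpp)).symm
          · rw [Function.update_of_ne hpq, Function.update_of_ne hpq']
            exact hc2 p (Finset.mem_erase.2 ⟨hpq, hp⟩) p' (Finset.mem_erase.2 ⟨hpq', hp'⟩) hpp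
    · rw [Finset.not_nonempty_iff_eq_empty] at hS
      subst hS
      exact ⟨fun _ => default, by simp, by simp⟩

/-- List coloring when the lists are at least as large as the degrees and each closed set of
vertices has a vertex whose list is larger than its degree. -/
theorem exists_list_coloring_of_slack (r : Q → Q → Prop) [DecidableRel r]
    (hr : ∀ p q, r p q → r q p) (hirr : ∀ p, ¬ r p p) (L : Q → Finset C) [Inhabited C]
    (S : Finset Q) (hdeg : ∀ q ∈ S, (S.filter (r q)).card ≤ (L q).card)
    (h : ∀ T ⊆ S, T.Nonempty → (∀ q ∈ T, ∀ p ∈ S, r q p → p ∈ T) →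
      ∃ q ∈ T, (S.filter (r q)).card < (L q).card) :
    ∃ c : Q → C, (∀ q ∈ S, c q ∈ L q) ∧ ∀ p ∈ S, ∀ q ∈ S, r p q → c p ≠ c q := by
  refine exists_list_coloring r hr hirr L S fun T hT hne => ?_
  by_cases hcl : ∀ q ∈ T, ∀ p ∈ S, r q p → p ∈ T
  · obtain ⟨q, hq, hlt⟩ := h T hT hne hcl
    exact ⟨q, hq, (Finset.card_le_card (Finset.filter_subset_filter _ hT)).trans_lt hlt⟩
  · push Not at hcl
    obtain ⟨q, hq, p, hp, hqp, hpT⟩ := hcl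
    -- This vertex has a neighbor in `S` outside `T`, so its degree within `T` is strictly below the
    -- size of its list.
    refine ⟨q, hq, (Finset.card_lt_card ?_).trans_le (hdeg q (hT hq))⟩
    refine Finset.ssubset_iff_subset_ne.2 ⟨Finset.filter_subset_filter _ hT, fun heq => hpT ?_⟩
    have : p ∈ S.filter (r q) := Finset.mem_filter.2 ⟨hp, hqp⟩
    rw [← heq] at this
    exact (Finset.mem_filter.1 this).1

/-- The graph of a function can be colored with three colors. -/
theorem exists_coloring_of_function [Fintype Q] (f : Q → Q) :
    ∃ R : Q → Fin 3, ∀ a, f a ≠ a → R a ≠ R (f a) := by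
  obtain ⟨c, -, hc⟩ := exists_list_coloring (C := Fin 3)
    (fun p q : Q => p ≠ q ∧ (f p = q ∨ f q = p)) (fun p q h => ⟨h.1.symm, h.2.symm⟩)
    (fun p h => h.1 rfl) (fun _ => Finset.univ) Finset.univ (by
      -- If every vertex of `T` had three neighbors in `T`, at most one of them would be its image,
      -- so it would have at least two preimages in `T`. But the preimages number at most `T.card`
      -- in all.
      intro T _ hT
      by_contra! hcon
      simp only [Finset.card_univ, Fintype.card_fin] at hcon
      have hin : ∀ q ∈ T, 2 ≤ (T.filter (fun p => f p = q)).card := by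
        intro q hq
        have hsub : T.filter (fun p => q ≠ p ∧ (f q = p ∨ f p = q)) ⊆
            insert (f q) (T.filter (fun p => f p = q)) := by
          intro p
          simp only [Finset.mem_filter, Finset.mem_insert]
          rintro ⟨h1, -, h2 | h2⟩
          · exact .inl h2.symm
          · exact .inr ⟨h1, h2⟩
        have := (hcon q hq).trans ((Finset.card_le_card hsub).trans (Finset.card_insert_le _ _))
        omega
      have h1 : ∑ q ∈ T, (T.filter (fun p => f p = q)).card ≤ T.card := by
        rw [← Finset.card_biUnion]
        · refine Finset.card_le_card fun p => ?_
          simp only [Finset.mem_biUnion, Finset.mem_filter]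
          rintro ⟨_, _, h, _⟩
          exact h
        · intro x _ y _ hxy
          refine Finset.disjoint_left.2 fun p hp hp' => hxy ?_
          rw [← (Finset.mem_filter.1 hp).2, ← (Finset.mem_filter.1 hp').2]
      have h2 := Finset.sum_le_sum hin
      rw [Finset.sum_const, smul_eq_mul] at h2
      have := hT.card_pos
      omega)
  exact ⟨c, fun a ha => hc a (Finset.mem_univ _) _ (Finset.mem_univ _) ⟨ha.symm, .inl rfl⟩⟩

end ListColoring

end ColorBlind
namespace ColorBlind

/-! ### From type colorings to edge colorings. -/

section Realization

variable {V : Type*} {G : SimpleGraph V} [Fintype V] [DecidableRel G.Adj]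

/-- Four pairwise adjacent vertices would need four types. -/
theorem IsFullTypeColoring.not_adj {τ : V → Fin 3} (h : IsFullTypeColoring G τ) {x y z w : V}
    (hd : IsDiamond G x y z w) : ¬ G.Adj x w := by
  intro hxw
  obtain ⟨-, h2, h3, h4, h5, h6⟩ := hd
  have e1 := h.proper _ _ h2
  have e2 := h.proper _ _ h3
  have e3 := h.proper _ _ h4
  have e4 := h.proper _ _ h5
  have e5 := h.proper _ _ h6
  have e6 := h.proper _ _ hxw
  omega

/-- The vertex `a` of type 0 is in the same triangle or diamond as `v`. -/
def IsCenter (G : SimpleGraph V) (τ : V → Fin 3) (v a : V) : Prop :=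
  τ a = 0 ∧ (v = a ∨ InnerAdj G v a)

theorem exists_center (H : IsTriangleLeafGraph G) {τ : V → Fin 3} (h : IsFullTypeColoring G τ)
    {v : V} (hv : G.degree v = 3) : ∃ a, IsCenter G τ v a := by
  obtain ⟨p, q, r, ht, hpq⟩ := H.exists_triangle hv
  have e1 := h.proper _ _ ht.adj₁
  have e2 := h.proper _ _ ht.adj₂
  have e3 := h.proper _ _ hpq
  have : τ v = 0 ∨ τ p = 0 ∨ τ q = 0 := by omega
  rcases this with h0 | h0 | h0
  · exact ⟨v, h0, .inl rfl⟩
  · exact ⟨p, h0, .inr ⟨ht.adj₁, q, ht.adj₂, hpq⟩⟩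
  · exact ⟨q, h0, .inr ⟨ht.adj₂, p, ht.adj₁, hpq.symm⟩⟩

/-- Two type-0 vertices sharing triangles with `v` are not adjacent, so both triangles use the third
neighbor of `v`. The two vertices are then the ends of a diamond, which may not have type 0. -/
theorem center_unique (H : IsTriangleLeafGraph G) {τ : V → Fin 3} (h : IsFullTypeColoring G τ)
    {v a b : V} (ha : IsCenter G τ v a) (hb : IsCenter G τ v b) : a = b := by
  by_contra hab
  obtain ⟨ha0, ha⟩ := ha
  obtain ⟨hb0, hb⟩ := hb
  rcases ha with rfl | ha <;> rcases hb with rfl | hb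
  · exact hab rfl
  · exact h.proper _ _ hb.1 (ha0.trans hb0.symm)
  · exact h.proper _ _ ha.1 (hb0.trans ha0.symm)
  · obtain ⟨q, hq⟩ := H.exists_nbrTriple ha.1 hb.1 hab
    have hnab : ¬ G.Adj a b := fun hh => h.proper _ _ hh (ha0.trans hb0.symm)
    have key : G.Adj a q ∧ G.Adj b q := by
      obtain ⟨_, s, hs1, hs2⟩ := ha
      obtain ⟨_, t, ht1, ht2⟩ := hb
      constructor
      · rcases hq.eq_or hs1 with rfl | rfl | rfl
        exacts [(hs2.ne rfl).elim, (hnab hs2).elim, hs2]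
      · rcases hq.eq_or ht1 with rfl | rfl | rfl
        exacts [(hnab ht2.symm).elim, (ht2.ne rfl).elim, ht2]
    exact h.diamond a v q b ⟨hab, ha.1.symm, key.1, hq.adj₃, hb.1, key.2.symm⟩ ha0

/-- The structure of a triangle outside the diamonds, relative to its vertex of type 0. -/
theorem triangle_structure (H : IsTriangleLeafGraph G) {τ : V → Fin 3}
    (h : IsFullTypeColoring G τ) {a : V} (ha : τ a = 0) (hd : ¬ InDiamond G a) :
    ∃ s t a' s' t', τ s = 1 ∧ τ t = 2 ∧ NbrTriple G a s t a' ∧ NbrTriple G s a t s' ∧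
      NbrTriple G t a s t' ∧ OuterAdj G a a' ∧ OuterAdj G s s' ∧ OuterAdj G t t' := by
  have ha3 : G.degree a = 3 := (H.deg a).resolve_left fun hl => h.leaf a hl ha
  obtain ⟨s, t, a', hta, hst, ho, hs, ht⟩ : ∃ s t a', NbrTriple G a s t a' ∧ G.Adj s t ∧
      OuterAdj G a a' ∧ τ s = 1 ∧ τ t = 2 := by
    obtain ⟨p, q, r, hp, hpq, ho⟩ := H.exists_triangle_of_not_inDiamond ha3 hd
    have e1 := h.proper _ _ hp.adj₁
    have e2 := h.proper _ _ hp.adj₂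
    have e3 := h.proper _ _ hpq
    have : (τ p = 1 ∧ τ q = 2) ∨ (τ q = 1 ∧ τ p = 2) := by omega
    rcases this with hh | hh
    · exact ⟨p, q, r, hp, hpq, ho, hh⟩
    · exact ⟨q, p, r, hp.swap, hpq.symm, ho, hh⟩
  have key : ∀ s t, G.Adj a s → G.Adj a t → G.Adj s t →
      ∃ s', NbrTriple G s a t s' ∧ OuterAdj G s s' := by
    intro s t has hat hst
    have hsd : ¬ InDiamond G s := fun hh => hd (H.inDiamond_of_innerAdj hh ⟨has.symm, t, hst, hat⟩)
    obtain ⟨s', hs'⟩ := H.exists_nbrTriple has.symm hst hat.ne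
    obtain ⟨p, q, r, hp, hpq, hsr⟩ := H.exists_triangle_of_not_inDiamond hs'.degree_eq hsd
    rcases hs'.eq_or hsr.1 with rfl | rfl | rfl
    · exact (hsr.2 t hst hat).elim
    · exact (hsr.2 a has.symm hat.symm).elim
    · exact ⟨_, hs', hsr⟩
  obtain ⟨s', hs', hso⟩ := key s t hta.adj₁ hta.adj₂ hst
  obtain ⟨t', ht', hto⟩ := key t s hta.adj₂ hta.adj₁ hst.symm
  exact ⟨s, t, a', s', t', hs, ht, hta, hs', ht', ho, hso, hto⟩

/-- The structure of a diamond, relative to its vertex of type 0. -/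
theorem diamond_structure (H : IsTriangleLeafGraph G) {τ : V → Fin 3}
    (h : IsFullTypeColoring G τ) {a : V} (ha : τ a = 0) (hd : InDiamond G a) :
    ∃ x z w x' w', IsDiamond G x a z w ∧ τ w = τ x ∧ τ x ≠ 0 ∧ τ z ≠ 0 ∧ τ z ≠ τ x ∧
      NbrTriple G x a z x' ∧ NbrTriple G w a z w' ∧ OuterAdj G x x' ∧ OuterAdj G w w' := by
  rcases hd.end_or_middle with ⟨y, z, w, hD⟩ | ⟨x, z, w, hD⟩
  · exact (h.diamond _ _ _ _ hD ha).elim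
  · have hn := h.not_adj hD
    obtain ⟨x', hx, hxo⟩ := H.end_outerAdj hD hn
    obtain ⟨w', hw, hwo⟩ := H.end_outerAdj hD.symm fun hh => hn hh.symm
    have h1 := h.diamond _ _ _ _ hD
    have h2 := h.diamond _ _ _ _ hD.symm
    have h3 := h.proper _ _ hD.2.2.1
    have h4 := h.proper _ _ hD.2.2.2.1
    have h5 := h.proper _ _ hD.2.2.2.2.2
    exact ⟨x, z, w, x', w', hD, by omega, by omega, by omega, by omega, hx, hw, hxo, hwo⟩

/-- A color different from two given colors. -/
def avoid (p q : Fin 3) : Fin 3 := if p = q then p + 1 else -(p + q)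

theorem avoid_comm (p q : Fin 3) : avoid p q = avoid q p := by revert p q; decide

theorem avoid_ne (p q : Fin 3) : avoid p q ≠ p ∧ avoid p q ≠ q := by revert p q; decide

/-- Given the center map `μ`, there is a coloring `R` of the centers that gives different colors to
centers joined by an edge at a vertex of type 2, if one of them is outside the diamonds. -/
theorem exists_center_coloring (H : IsTriangleLeafGraph G) {τ : V → Fin 3}
    (h : IsFullTypeColoring G τ) (μ : V → V) (hμ : ∀ v a, IsCenter G τ v a → μ v = a)
    (hμ1 : ∀ v, G.degree v = 1 → μ v = v) :
    ∃ R : V → Fin 3, ∀ u v, OuterAdj G u v → τ u = 2 → τ v ≠ 2 →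
      (¬ InDiamond G v → R (μ u) ≠ R (μ v)) := by
  classical
  have hin : ∀ u, G.degree u = 3 → τ u = 2 → InnerAdj G u (μ u) ∧ τ (μ u) = 0 := by
    intro u hu h2
    obtain ⟨a, ha⟩ := exists_center H h hu
    rw [hμ u a ha]
    obtain ⟨h0, rfl | hh⟩ := ha
    · rw [h0] at h2; exact absurd h2 (by decide)
    · exact ⟨hh, h0⟩
  have hdia : ∀ u, InDiamond G (μ u) → InDiamond G u := by
    intro u hd
    rcases H.deg u with hu | hu
    · rwa [hμ1 u hu] at hd
    · obtain ⟨a, ha⟩ := exists_center H h hu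
      rw [hμ u a ha] at hd
      obtain ⟨h0, rfl | hh⟩ := ha
      · exact hd
      · exact H.inDiamond_of_innerAdj hd hh.symm
  have hne : ∀ u v, OuterAdj G u v → τ u = 2 → μ u ≠ μ v := by
    intro u v huv h2 heq
    rcases H.deg v with hv | hv
    · have hu := H.leaf v u huv.1.symm hv
      have := (hin u hu h2).2
      rw [heq, hμ1 v hv] at this
      exact h.leaf v hv this
    · obtain ⟨b, hb⟩ := exists_center H h hv
      rw [hμ v b hb] at heq
      rcases H.deg u with hu | hu
      · rw [hμ1 u hu] at heq
        rw [heq] at h2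
        rw [hb.1] at h2
        exact absurd h2 (by decide)
      · have hu' := hin u hu h2
        rw [heq] at hu'
        obtain ⟨h0, rfl | hh⟩ := hb
        · exact hu'.1.not_outerAdj huv
        · exact huv.2 _ hu'.1.1 hh.1
  -- Each piece outside the diamonds has just one vertex of type 2. This makes the next relation
  -- between centers a function.
  have huniq : ∀ u p, ¬ InDiamond G u → τ u = 2 → τ p = 2 → μ u = μ p → u = p := by
    intro u p hd hu hp heq
    rcases H.deg u with hu1 | hu3 <;> rcases H.deg p with hp1 | hp3
    · rwa [hμ1 u hu1, hμ1 p hp1] at heq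
    · have := (hin p hp3 hp).2
      rw [← heq, hμ1 u hu1, hu] at this
      exact absurd this (by decide)
    · have := (hin u hu3 hu).2
      rw [heq, hμ1 p hp1, hp] at this
      exact absurd this (by decide)
    · have e1 := (hin u hu3 hu).1
      have e2 := (hin p hp3 hp).1
      rw [← heq] at e2
      by_contra hup
      have hda : ¬ InDiamond G (μ u) := fun hh => hd (hdia u hh)
      exact h.proper _ _ (H.innerAdj_adj hda e1.symm e2.symm hup) (hu.trans hp.symm)
  -- Sends a center to the center across the outer edge at its type-2 vertex. The default value `a`
  -- imposes no condition on `R`.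
  let f : V → V := fun a =>
    if hc : ∃ v, ∃ u, μ u = a ∧ τ u = 2 ∧ OuterAdj G u v then μ hc.choose else a
  obtain ⟨R, hR⟩ := exists_coloring_of_function f
  -- the value of `f` at a center outside the diamonds is the center across the edge at type 2
  have hf : ∀ u v, OuterAdj G u v → τ u = 2 → ¬ InDiamond G u → f (μ u) = μ v := by
    intro u v huv h2 hd
    have hc : ∃ v, ∃ p, μ p = μ u ∧ τ p = 2 ∧ OuterAdj G p v := ⟨v, u, rfl, h2, huv⟩
    obtain ⟨p, hp1, hp2, hp3⟩ := hc.choose_spec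
    have hup := huniq u p hd h2 hp2 hp1.symm
    subst hup
    have : f (μ u) = μ hc.choose := dif_pos hc
    rw [this, H.outerAdj_unique hp3 huv]
  -- A diamond has two outer edges, hence at most two colors to avoid, and three colors are enough.
  -- No constraint has its type-2 end outside a diamond and its other end in one, so these colors
  -- can be chosen last.
  have hext : ∀ a, ∃ κ : Fin 3, (¬ InDiamond G a → κ = R a) ∧
      (InDiamond G a → τ a = 0 → ∀ u v, μ u = a → OuterAdj G u v → κ ≠ R (μ v)) := by
    intro a
    by_cases hc : InDiamond G a ∧ τ a = 0
    · obtain ⟨x, z, w, x', w', hD, hwx, hx0, hz0, hzx, hx, hw, hxo, hwo⟩ :=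
        diamond_structure H h hc.2 hc.1
      refine ⟨avoid (R (μ x')) (R (μ w')), fun hh => (hh hc.1).elim, fun _ _ u v hu huv => ?_⟩
      rcases H.deg u with hu1 | hu3
      · rw [hμ1 u hu1] at hu
        subst hu
        exact (h.leaf _ hu1 hc.2).elim
      · obtain ⟨b, hb⟩ := exists_center H h hu3
        rw [hμ u b hb] at hu
        subst hu
        obtain ⟨_, rfl | hh⟩ := hb
        · exact (H.middle_not_outerAdj hD huv).elim
        · rcases (H.middle_triple hD).eq_or hh.1.symm with rfl | rfl | rfl
          · rw [H.outerAdj_unique huv hxo]; exact (avoid_ne _ _).1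
          · exact (H.middle_not_outerAdj hD.swap huv).elim
          · rw [H.outerAdj_unique huv hwo]; exact (avoid_ne _ _).2
    · exact ⟨R a, fun _ => rfl, fun h1 h2 => (hc ⟨h1, h2⟩).elim⟩
  choose R' hR1 hR2 using hext
  refine ⟨R', fun u v huv h2 _ hdv => ?_⟩
  have hv : ¬ InDiamond G (μ v) := fun hh => hdv (hdia v hh)
  rw [hR1 _ hv]
  by_cases hdu : InDiamond G (μ u)
  · have hu3 : G.degree u = 3 := H.degree_of_inDiamond (hdia u hdu)
    exact hR2 _ hdu (hin u hu3 h2).2 u v rfl huv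
  · have hdu' : ¬ InDiamond G u := by
      intro hh
      have hu3 := H.degree_of_inDiamond hh
      exact hdu (H.inDiamond_of_innerAdj hh (hin u hu3 h2).1)
    rw [hR1 _ hdu]
    have := hR (μ u)
    rw [hf u v huv h2 hdu'] at this
    exact this (hne u v huv h2).symm

/-- The colors of the edges inside a triangle or a diamond. -/
theorem exists_inner_coloring (H : IsTriangleLeafGraph G) {τ : V → Fin 3}
    (h : IsFullTypeColoring G τ) (μ : V → V) (hμ : ∀ v a, IsCenter G τ v a → μ v = a)
    (O : V → V → Fin 3) (R : V → Fin 3)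
    (hO2 : ∀ u v, OuterAdj G u v → τ u = 2 → O u v = R (μ u))
    (hO1 : ∀ u v, OuterAdj G u v → τ u ≠ 2 → ¬ InDiamond G u → O u v ≠ R (μ u))
    {a : V} (ha : τ a = 0) :
    ∃ l : Sym2 V → Fin 3, ∀ K : V → V → Fin 3,
      (∀ u v, InnerAdj G u v → μ u = a → K u v = l s(u, v)) →
      (∀ u v, OuterAdj G u v → K u v = O u v) →
      ∀ v, (v = a ∨ InnerAdj G v a) → ∃ p q r, NbrTriple G v p q r ∧
        tripleType (K v p) (K v q) (K v r) = τ v := by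
  classical
  have hself : μ a = a := hμ a a ⟨ha, .inl rfl⟩
  by_cases hd : InDiamond G a
  · obtain ⟨x, z, w, x', w', hD, hwx, hx0, hz0, hzx, hx, hw, hxo, hwo⟩ := diamond_structure H h ha hd
    have hmid := H.middle_triple hD
    have hmid' := H.middle_triple hD.swap
    obtain ⟨hxw, hxa, hxz, haz, haw, hzw⟩ := hD
    have ixa : InnerAdj G x a := ⟨hxa, z, hxz, haz⟩
    have iza : InnerAdj G z a := ⟨haz.symm, w, hzw, haw⟩
    have iwa : InnerAdj G w a := ⟨haw.symm, z, hzw.symm, haz⟩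
    have ixz : InnerAdj G x z := ⟨hxz, a, hxa, haz.symm⟩
    have iwz : InnerAdj G w z := ⟨hzw.symm, a, haw.symm, haz.symm⟩
    have mx := hμ x a ⟨ha, .inr ixa⟩
    have mz := hμ z a ⟨ha, .inr iza⟩
    have mw := hμ w a ⟨ha, .inr iwa⟩
    have nxa := hxa.ne
    have nza := haz.ne
    have nwa := haw.ne
    have nxz := hxz.ne
    have nzw := hzw.ne
    -- `α` is for the edges at the center, `β` and `γ` for `xz` and `wz`. If the ends have type 2,
    -- both outer edges have the color `R a`, and `β = γ` works with `α`, `β`, `R a` distinct. If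
    -- they have type 1, a rainbow triple works for any outer colors: the two outer colors need only
    -- lie in {α, β} and {α, γ}.
    obtain ⟨α, β, γ, hz, hx₁, hw₁⟩ : ∃ α β γ : Fin 3,
        tripleType α β γ = τ z ∧ tripleType α β (O x x') = τ x ∧ tripleType α γ (O w w') = τ w := by
      by_cases h2 : τ x = 2
      · have e1 := hO2 x x' hxo h2
        have e2 := hO2 w w' hwo (hwx.trans h2)
        rw [mx] at e1
        rw [mw] at e2
        have hz1 : τ z = 1 := by omega
        rw [e1, e2, hwx, h2, hz1]
        generalize R a = κ
        revert κ; decide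
      · have hz2 : τ z = 2 := by omega
        have hx1 : τ x = 1 := by omega
        rw [hwx, hz2, hx1]
        generalize O x x' = e
        generalize O w w' = e'
        revert e e'; decide
    refine ⟨fun e => if a ∈ e then α else if x ∈ e then β else γ, fun K hKi hKo v hv => ?_⟩
    have kxa := hKi x a ixa mx
    have kax := hKi a x ixa.symm hself
    have kza := hKi z a iza mz
    have kaz := hKi a z iza.symm hself
    have kwa := hKi w a iwa mw
    have kaw := hKi a w iwa.symm hself
    have kxz := hKi x z ixz mx
    have kzx := hKi z x ixz.symm mz
    have kwz := hKi w z iwz mw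
    have kzw := hKi z w iwz.symm mz
    have kx := hKo _ _ hxo
    have kw := hKo _ _ hwo
    simp only [Sym2.mem_iff, nxa, nxa.symm, nza, nwa, nxz, hxw, or_false, or_true, if_true, if_false,
      or_self]
      at kxa kax kza kaz kwa kaw kxz kzx kwz kzw
    have hcases : v = a ∨ v = x ∨ v = z ∨ v = w := by
      rcases hv with rfl | hv
      · exact .inl rfl
      · exact .inr (hmid.eq_or hv.1.symm)
    rcases hcases with rfl | rfl | rfl | rfl
    · exact ⟨_, _, _, hmid, by rw [kax, kaz, kaw, ha]; simp [tripleType]⟩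
    · exact ⟨_, _, _, hx, by rw [kxa, kxz, kx]; exact hx₁⟩
    · exact ⟨_, _, _, hmid'.swap, by rw [kza, kzx, kzw]; exact hz⟩
    · exact ⟨_, _, _, hw, by rw [kwa, kwz, kw]; exact hw₁⟩
  · obtain ⟨s, t, a', s', t', hs, ht, hta, hts, htt, hao, hso, hto⟩ := triangle_structure H h ha hd
    have has := hta.adj₁
    have hat := hta.adj₂
    have hst := hts.adj₂
    have isa : InnerAdj G s a := ⟨has.symm, t, hst, hat⟩
    have ita : InnerAdj G t a := ⟨hat.symm, s, hst.symm, has⟩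
    have ist : InnerAdj G s t := ⟨hst, a, has.symm, hat.symm⟩
    have ms := hμ s a ⟨ha, .inr isa⟩
    have mt := hμ t a ⟨ha, .inr ita⟩
    have hsd : ¬ InDiamond G s := fun hh => hd (H.inDiamond_of_innerAdj hh isa)
    have e1 := hO1 a a' hao (by rw [ha]; decide) hd
    have e2 := hO1 s s' hso (by rw [hs]; decide) hsd
    have e3 := hO2 t t' hto ht
    rw [hself] at e1
    rw [ms] at e2
    rw [mt] at e3
    have nas := has.ne
    have nat := hat.ne
    have nst := hst.ne
    -- All edges at the center take the color of its outer edge, and `st` takes the color different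
    -- from that and from `R a`. So `t` sees three colors, while the outer color at `s`, not being
    -- `R a`, repeats one of the other two.
    refine ⟨fun e => if a ∈ e then O a a' else avoid (O a a') (R a), fun K hKi hKo v hv => ?_⟩
    have ksa := hKi s a isa ms
    have kas := hKi a s isa.symm hself
    have kta := hKi t a ita mt
    have kat := hKi a t ita.symm hself
    have kst := hKi s t ist ms
    have kts := hKi t s ist.symm mt
    have ka := hKo _ _ hao
    have ks := hKo _ _ hso
    have kt := hKo _ _ hto
    simp only [Sym2.mem_iff, nas, nat, or_false, or_true, if_true, if_false, or_self] at ksa kas kta kat kst kts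
    have hcases : v = a ∨ v = s ∨ v = t := by
      rcases hv with rfl | hv
      · exact .inl rfl
      · rcases hta.eq_or hv.1.symm with rfl | rfl | rfl
        exacts [.inr (.inl rfl), .inr (.inr rfl), (hv.symm.not_outerAdj hao).elim]
    rcases hcases with rfl | rfl | rfl
    · exact ⟨_, _, _, hta, by rw [kas, kat, ka, ha]; simp [tripleType]⟩
    · refine ⟨_, _, _, hts, ?_⟩
      rw [ksa, kst, ks, hs]
      revert e1 e2
      generalize O a a' = α
      generalize O v s' = β
      generalize R a = γ
      revert α β γ; decide
    · refine ⟨_, _, _, htt, ?_⟩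
      rw [kta, kts, kt, ht, e3]
      revert e1
      generalize O a a' = α
      generalize R a = γ
      revert α γ; decide

/-- Every full type coloring is given by an edge coloring. -/
theorem IsFullTypeColoring.exists_edgeLabeling (H : IsTriangleLeafGraph G) {τ : V → Fin 3}
    (h : IsFullTypeColoring G τ) :
    ∃ c : G.EdgeLabeling (Fin 3), ∀ v, G.degree v = 3 → vertexType c v = τ v := by
  classical
  have hμ : ∃ μ : V → V, (∀ v a, IsCenter G τ v a → μ v = a) ∧ ∀ v, G.degree v = 1 → μ v = v := by
    have : ∀ v, ∃ b, (∀ a, IsCenter G τ v a → b = a) ∧ (G.degree v = 1 → b = v) := by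
      intro v
      rcases H.deg v with hv | hv
      · refine ⟨v, fun a ha => ?_, fun _ => rfl⟩
        obtain ⟨_, rfl | hh⟩ := ha
        · rfl
        · have := H.degree_of_innerAdj hh
          omega
      · obtain ⟨a, ha⟩ := exists_center H h hv
        exact ⟨a, fun b hb => center_unique H h ha hb, fun h1 => by omega⟩
    choose μ h1 h2 using this
    exact ⟨μ, h1, h2⟩
  obtain ⟨μ, hμ, hμ1⟩ := hμ
  obtain ⟨R, hR⟩ := exists_center_coloring H h μ hμ hμ1
  -- A type-2 end dictates the color of an outer edge. Without one, the color only has to avoid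
  -- those of both centers. The last branch also covers two ends of type 2, which do not occur on an
  -- edge.
  let O : V → V → Fin 3 := fun u v =>
    if τ u = 2 ∧ τ v ≠ 2 then R (μ u) else if τ v = 2 ∧ τ u ≠ 2 then R (μ v)
    else avoid (R (μ u)) (R (μ v))
  have hOsymm : ∀ u v, O u v = O v u := by
    intro u v
    simp only [O]
    by_cases h1 : τ u = 2 <;> by_cases h2 : τ v = 2 <;> simp [h1, h2, avoid_comm]
  have hO2 : ∀ u v, OuterAdj G u v → τ u = 2 → O u v = R (μ u) := by
    intro u v huv hu
    exact if_pos ⟨hu, fun hv => h.proper _ _ huv.1 (hu.trans hv.symm)⟩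
  have hO1 : ∀ u v, OuterAdj G u v → τ u ≠ 2 → ¬ InDiamond G u → O u v ≠ R (μ u) := by
    intro u v huv hu hd
    simp only [O]
    by_cases hv : τ v = 2
    · simpa [hu, hv] using hR v u huv.symm hv hu hd
    · simpa [hu, hv] using (avoid_ne _ _).1
  have hl : ∀ a, ∃ l : Sym2 V → Fin 3, τ a = 0 → ∀ K : V → V → Fin 3,
      (∀ u v, InnerAdj G u v → μ u = a → K u v = l s(u, v)) →
      (∀ u v, OuterAdj G u v → K u v = O u v) →
      ∀ v, (v = a ∨ InnerAdj G v a) → ∃ p q r, NbrTriple G v p q r ∧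
        tripleType (K v p) (K v q) (K v r) = τ v := by
    intro a
    by_cases ha : τ a = 0
    · obtain ⟨l, hl⟩ := exists_inner_coloring H h μ hμ O R hO2 hO1 ha
      exact ⟨l, fun _ => hl⟩
    · exact ⟨fun _ => 0, fun h0 => (ha h0).elim⟩
  choose l hl using hl
  have hμsymm : ∀ u v, InnerAdj G u v → μ u = μ v := by
    intro u v huv
    have e1 := h.proper _ _ huv.1
    by_cases hu : τ u = 0
    · rw [hμ u u ⟨hu, .inl rfl⟩, hμ v u ⟨hu, .inr huv.symm⟩]
    by_cases hv : τ v = 0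
    · rw [hμ v v ⟨hv, .inl rfl⟩, hμ u v ⟨hv, .inr huv⟩]
    obtain ⟨huv, w, hw1, hw2⟩ := huv
    have e2 := h.proper _ _ hw1
    have e3 := h.proper _ _ hw2
    have hw : τ w = 0 := by omega
    rw [hμ u w ⟨hw, .inr ⟨hw1, v, huv, hw2.symm⟩⟩,
      hμ v w ⟨hw, .inr ⟨hw2, u, huv.symm, hw1.symm⟩⟩]
  let K : V → V → Fin 3 := fun u v => if InnerAdj G u v then l (μ u) s(u, v) else O u v
  have hK : ∀ u v, K u v = K v u := by
    intro u v
    simp only [K]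
    by_cases huv : InnerAdj G u v
    · rw [if_pos huv, if_pos huv.symm, hμsymm u v huv, Sym2.eq_swap]
    · rw [if_neg huv, if_neg fun hh => huv hh.symm, hOsymm]
  refine ⟨fun e => Sym2.lift ⟨K, hK⟩ e.1, fun v hv => ?_⟩
  obtain ⟨a, ha⟩ := exists_center H h hv
  obtain ⟨p, q, r, ht, htype⟩ := hl a ha.1 K
    (fun u v huv hu => by simp only [K]; rw [if_pos huv, hu])
    (fun u v huv => by simp only [K]; rw [if_neg fun hh : InnerAdj G u v => hh.not_outerAdj huv])
    v ha.2
  exact (ht.vertexType_eq _).trans htype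

theorem IsTypeColoring.exists_distinguishing (H : IsTriangleLeafGraph G) {τ : V → Fin 3}
    (h : IsTypeColoring G ∅ τ) :
    ∃ c : G.EdgeLabeling (Fin 3), IsColorBlindDistinguishing c ∧
      ∀ v, G.degree v = 3 → vertexType c v = τ v := by
  obtain ⟨τ', h', heq⟩ := h.exists_full H
  obtain ⟨c, hc⟩ := h'.exists_edgeLabeling H
  refine ⟨c, fun u v huv => ?_, fun v hv => (hc v hv).trans (heq v hv)⟩
  rcases H.deg u with hu | hu
  · exact colorBlindPartition_ne_of_degree c hu (H.leaf u v huv hu)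
  · rcases H.deg v with hv | hv
    · exact (colorBlindPartition_ne_of_degree c hv hu).symm
    · rw [Ne, colorBlindPartition_eq_iff_vertexType c c hu hv, hc u hu, hc v hv]
      exact h'.proper u v huv

end Realization

end ColorBlind
namespace ColorBlind

/-! ### Exchanging types along alternating chains. -/

section Kempe

variable {V : Type*} {G : SimpleGraph V} [Fintype V] [DecidableRel G.Adj]

theorem IsTypeColoring.of_ne {τ : V → Fin 3} {u v : V} (h : IsTypeColoring G {s(u, v)} τ)
    (huv : G.degree u = 3 → G.degree v = 3 → τ u ≠ τ v) : IsTypeColoring G ∅ τ := by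
  refine ⟨fun p q hp hq hpq _ => ?_, h.diamond⟩
  by_cases he : s(p, q) = s(u, v)
  · rcases Sym2.eq_iff.1 he with ⟨rfl, rfl⟩ | ⟨rfl, rfl⟩
    · exact huv hp hq
    · exact (huv hq hp).symm
  · exact h.proper p q hp hq hpq he

theorem IsTypeColoring.comp {D : Set (Sym2 V)} {τ : V → Fin 3} (h : IsTypeColoring G D τ)
    (σ : Equiv.Perm (Fin 3)) (hσ : ∀ x y z w, IsDiamond G x y z w → σ (τ x) ≠ 0) :
    IsTypeColoring G D (σ ∘ τ) :=
  ⟨fun u v hu hv huv hD heq => h.proper u v hu hv huv hD (σ.injective heq), hσ⟩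

/-- Ends of diamonds do not have type 0, and middle vertices have no outer edge. -/
theorem IsTypeColoring.not_inDiamond (H : IsTriangleLeafGraph G) {D : Set (Sym2 V)}
    {τ : V → Fin 3} (h : IsTypeColoring G D τ) {p q : V} (hpq : OuterAdj G p q) (hp : τ p = 0) :
    ¬ InDiamond G p := by
  intro hd
  rcases hd.end_or_middle with ⟨y, z, w, hD⟩ | ⟨x, z, w, hD⟩
  · exact h.diamond _ _ _ _ hD hp
  · exact H.middle_not_outerAdj hD hpq

/-- The alternating chain of vertices of types 0 and 1 that starts at `v` and does not use the
edge `uv`. -/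
inductive KempeChain (G : SimpleGraph V) [DecidableRel G.Adj] (τ : V → Fin 3) (u v : V) : V → Prop
  | start : KempeChain G τ u v v
  | inner {p q : V} : KempeChain G τ u v p → τ p = 0 → InnerAdj G p q → τ q = 1 →
      KempeChain G τ u v q
  | outer {p q : V} : KempeChain G τ u v p → τ p = 1 → OuterAdj G p q → G.degree q = 3 → τ q = 0 →
      s(p, q) ≠ s(u, v) → KempeChain G τ u v q

/-- Inner steps stay in a triangle outside the diamonds, and outer steps reach a vertex of type 0
with an outer edge, which is again outside them. Hence the exchange never gives type 0 to the end of
a diamond. The predecessor is recorded because it is the only other candidate neighbor in the chain.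
-/
theorem KempeChain.spec (H : IsTriangleLeafGraph G) {τ : V → Fin 3} {u v : V}
    (huv : OuterAdj G u v) (hv : G.degree v = 3) (h : IsTypeColoring G {s(u, v)} τ)
    (hv0 : τ v = 0) {p : V} (hp : KempeChain G τ u v p) :
    ¬ InDiamond G p ∧ G.degree p = 3 ∧
      ((τ p = 0 ∧ (p = v ∨ ∃ q, KempeChain G τ u v q ∧ τ q = 1 ∧ OuterAdj G p q)) ∨
        (τ p = 1 ∧ ∃ q, KempeChain G τ u v q ∧ τ q = 0 ∧ InnerAdj G p q)) := by
  induction hp with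
  | start => exact ⟨h.not_inDiamond H huv.symm hv0, hv, .inl ⟨hv0, .inl rfl⟩⟩
  | @inner p q hp h0 hpq h1 ih =>
    exact ⟨fun hd => ih.1 (H.inDiamond_of_innerAdj hd hpq.symm), H.degree_of_innerAdj hpq.symm,
      .inr ⟨h1, p, hp, h0, hpq.symm⟩⟩
  | @outer p q hp h1 hpq h3 h0 hne ih =>
    exact ⟨h.not_inDiamond H hpq.symm h0, h3, .inl ⟨h0, .inr ⟨p, hp, h1, hpq.symm⟩⟩⟩

/-- Exchanging the types 0 and 1 along the chain that starts at `v`. -/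
theorem IsTypeColoring.exists_kempe_swap (H : IsTriangleLeafGraph G) {τ : V → Fin 3} {u v : V}
    (huv : OuterAdj G u v) (hv : G.degree v = 3) (h : IsTypeColoring G {s(u, v)} τ)
    (hv0 : τ v = 0) (hu : G.degree u = 3 → τ u = 0) :
    ∃ τ', IsTypeColoring G ∅ τ' ∧ τ' v = 1 := by
  classical
  let K : V → Prop := KempeChain G τ u v
  have hspec := fun p (hp : K p) => KempeChain.spec H huv hv h hv0 hp
  let τ' : V → Fin 3 := fun p => if K p then (if τ p = 0 then 1 else 0) else τ p
  have hτv : τ' v = 1 := by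
    simp only [τ']
    rw [if_pos KempeChain.start, if_pos hv0]
  have hout : ∀ p q, K p → ¬ K q → G.Adj p q → G.degree q = 3 → s(p, q) ≠ s(u, v) →
      τ' p ≠ τ' q := by
    intro p q hp hq hpq hq3 hne
    simp only [τ']
    rw [if_pos hp, if_neg hq]
    obtain ⟨hd, hp3, ⟨h0, hh⟩ | ⟨h1, t, ht, ht0, hpt⟩⟩ := hspec p hp
    · rw [if_pos h0]
      intro hq1
      rcases innerAdj_or_outerAdj hpq with hi | ho
      · exact hq (KempeChain.inner hp h0 hi hq1.symm)
      · rcases hh with rfl | ⟨t, ht, _, hpt⟩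
        · have := H.outerAdj_unique ho huv.symm
          subst this
          exact hne Sym2.eq_swap
        · rw [H.outerAdj_unique ho hpt] at hq
          exact hq ht
    · rw [if_neg (by rw [h1]; decide)]
      intro hq0
      rcases innerAdj_or_outerAdj hpq with hi | ho
      · have htq : t ≠ q := fun hh => hq (hh ▸ ht)
        have hadj := H.innerAdj_adj hd hpt hi htq
        refine h.proper t q (H.degree_of_innerAdj hpt.symm) hq3 hadj ?_ (ht0.trans hq0)
        intro he
        have hin : InnerAdj G t q := ⟨hadj, p, hpt.1.symm, hi.1.symm⟩
        rcases Sym2.eq_iff.1 he with ⟨rfl, rfl⟩ | ⟨rfl, rfl⟩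
        · exact hin.not_outerAdj huv
        · exact hin.symm.not_outerAdj huv
      · exact hq (KempeChain.outer hp h1 ho hq3 hq0.symm hne)
  have hτu : G.degree u = 3 → τ' u = 0 := by
    intro hu3
    -- The chain could enter `u`, of type 0, only through its outer edge from a vertex of type 1;
    -- but that edge leads to `v`, of type 0.
    have hnu : ¬ K u := by
      intro hk
      obtain ⟨_, _, ⟨_, hh⟩ | ⟨h1, _⟩⟩ := hspec u hk
      · rcases hh with rfl | ⟨q, _, hq1, huq⟩
        · exact huv.1.ne rfl
        · rw [H.outerAdj_unique huq huv, hv0] at hq1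
          exact absurd hq1 (by decide)
      · rw [hu hu3] at h1
        exact absurd h1 (by decide)
    simp only [τ']
    rw [if_neg hnu, hu hu3]
  have hoff : IsTypeColoring G {s(u, v)} τ' := by
    refine ⟨fun p q hp hq hpq hD => ?_, fun x y z w hD => ?_⟩
    · have hne : s(p, q) ≠ s(u, v) := hD
      by_cases hkp : K p <;> by_cases hkq : K q
      · have h1 := h.proper p q hp hq hpq hD
        have h2 : τ p = 0 ∨ τ p = 1 := (hspec p hkp).2.2.imp And.left And.left
        have h3 : τ q = 0 ∨ τ q = 1 := (hspec q hkq).2.2.imp And.left And.left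
        simp only [τ']
        rw [if_pos hkp, if_pos hkq]
        rcases h2 with h2 | h2 <;> rcases h3 with h3 | h3 <;> simp_all
      · exact hout p q hkp hkq hpq hq hne
      · exact (hout q p hkq hkp hpq.symm hp (by rwa [Sym2.eq_swap])).symm
      · simp only [τ']
        rw [if_neg hkp, if_neg hkq]
        exact h.proper p q hp hq hpq hD
    · have hnx : ¬ K x := fun hk => (hspec x hk).1 hD.inDiamond₁
      simp only [τ']
      rw [if_neg hnx]
      exact h.diamond x y z w hD
  refine ⟨τ', hoff.of_ne fun hu3 _ => ?_, hτv⟩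
  rw [hτu hu3, hτv]
  decide

end Kempe

/-! ### Greedy type colorings of connected graphs. -/

section Greedy

variable {V : Type*} {G : SimpleGraph V}

theorem mem_of_closed (hconn : G.Connected) {U : Set V} (hU : ∀ p ∈ U, ∀ q, G.Adj p q → q ∈ U)
    {p : V} (hp : p ∈ U) (q : V) : q ∈ U := by
  obtain ⟨W⟩ := hconn.preconnected p q
  induction W with
  | nil => exact hp
  | cons h _ ih => exact ih (hU _ hp _ h)

variable [Fintype V] [DecidableRel G.Adj]

/-- A set that contains exactly one of the middle vertices of each diamond. -/
structure IsMiddleSelection (G : SimpleGraph V) (Y : Finset V) : Prop where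
  iff : ∀ x y z w, IsDiamond G x y z w → (y ∈ Y ↔ z ∉ Y)
  middle : ∀ y ∈ Y, ∃ x z w, IsDiamond G x y z w

/-- When the ends are not adjacent, a middle vertex determines its partner, so the smaller of the
two in a fixed numbering can be selected consistently. -/
theorem exists_isMiddleSelection (H : IsTriangleLeafGraph G)
    (hK : ∀ x y z w, IsDiamond G x y z w → ¬ G.Adj x w) : ∃ Y, IsMiddleSelection G Y := by
  classical
  let e := Fintype.equivFin V
  have key : ∀ x y z w x' z' w', IsDiamond G x y z w → IsDiamond G x' y z' w' → z' = z := by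
    intro x y z w x' z' w' h h'
    have h1 := h'.2.2.1
    have h2 := h'.2.2.2.2.2
    have ht := H.middle_triple h
    have ht' := H.middle_triple h'
    have hxw := hK _ _ _ _ h
    have hw : G.Adj y w := ht.adj₃
    have hx : G.Adj y x := ht.adj₁
    have hnz : ∀ t, G.Adj y t → t ≠ z' → G.Adj z' t := by
      intro t hyt htz
      rcases ht'.eq_or hyt with rfl | rfl | rfl
      exacts [h1.symm, (htz rfl).elim, h2]
    rcases ht.eq_or ht'.adj₂ with rfl | rfl | rfl
    · exact (hxw (hnz w hw h.1.symm)).elim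
    · rfl
    · exact (hxw (hnz x hx h.1).symm).elim
  refine ⟨Finset.univ.filter fun y => ∃ x z w, IsDiamond G x y z w ∧ e y < e z, fun x y z w h => ?_,
    fun y hy => ?_⟩
  · have aux : ∀ x y z w, IsDiamond G x y z w →
        (y ∈ Finset.univ.filter (fun y => ∃ x z w, IsDiamond G x y z w ∧ e y < e z) ↔ e y < e z) := by
      intro x y z w h
      rw [Finset.mem_filter]
      constructor
      · rintro ⟨_, x', z', w', h', hlt⟩
        rwa [key _ _ _ _ _ _ _ h h'] at hlt
      · exact fun hlt => ⟨Finset.mem_univ _, x, z, w, h, hlt⟩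
    rw [aux x y z w h, aux x z y w h.swap, not_lt]
    have hne : e y ≠ e z := fun hh => h.2.2.2.1.ne (e.injective hh)
    exact ⟨le_of_lt, fun hle => lt_of_le_of_ne hle hne⟩
  · obtain ⟨x, z, w, h, _⟩ := (Finset.mem_filter.1 hy).2
    exact ⟨x, z, w, h⟩

namespace IsMiddleSelection

variable {Y : Finset V} (hY : IsMiddleSelection G Y) (H : IsTriangleLeafGraph G)
include hY H

theorem not_mem_of_outerAdj {p q : V} (hpq : OuterAdj G p q) : p ∉ Y := by
  intro hp
  obtain ⟨x, z, w, h⟩ := hY.middle p hp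
  exact H.middle_not_outerAdj h hpq

theorem end_not_mem (hK : ∀ x y z w, IsDiamond G x y z w → ¬ G.Adj x w) {x y z w : V}
    (h : IsDiamond G x y z w) : x ∉ Y := by
  obtain ⟨x', _, hx⟩ := H.end_outerAdj h (hK _ _ _ _ h)
  exact hY.not_mem_of_outerAdj H hx

theorem nbr (hK : ∀ x y z w, IsDiamond G x y z w → ¬ G.Adj x w) {y p : V} (hy : y ∈ Y)
    (hyp : G.Adj y p) : p ∉ Y ∧ InDiamond G p := by
  obtain ⟨x, z, w, h⟩ := hY.middle y hy
  rcases (H.middle_triple h).eq_or hyp with rfl | rfl | rfl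
  · exact ⟨hY.end_not_mem H hK h, h.inDiamond₁⟩
  · exact ⟨(hY.iff _ _ _ _ h).1 hy, h.inDiamond₃⟩
  · exact ⟨hY.end_not_mem H hK h.symm, h.inDiamond₄⟩

omit H [Fintype V] [DecidableRel G.Adj] in
theorem exists_nbr {q : V} (hq : InDiamond G q) (hqY : q ∉ Y) : ∃ y ∈ Y, G.Adj q y := by
  rcases hq.end_or_middle with ⟨y, z, w, h⟩ | ⟨x, z, w, h⟩
  · by_cases hy : y ∈ Y
    · exact ⟨y, hy, h.2.1⟩
    · exact ⟨z, by by_contra hz; exact hy ((hY.iff _ _ _ _ h).2 hz), h.2.2.1⟩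
  · exact ⟨z, by by_contra hz; exact hqY ((hY.iff _ _ _ _ h).2 hz), h.2.2.2.1⟩

end IsMiddleSelection

open Classical in
/-- The types that are allowed at a vertex which is not a selected middle vertex. -/
noncomputable def typeList (G : SimpleGraph V) (v : V) : Finset (Fin 3) :=
  if InDiamond G v then {1, 2} else Finset.univ

omit [Fintype V] [DecidableRel G.Adj] in
theorem ne_zero_of_mem_typeList {v : V} {t : Fin 3} (ht : t ∈ typeList G v) (hv : InDiamond G v) :
    t ≠ 0 := by
  rw [typeList, if_pos hv] at ht
  revert ht; revert t; decide

/-- A free vertex in a diamond loses type 0 from its list, but also loses a selected neighbor from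
its degree. -/
theorem card_le_typeList {Y : Finset V} (hY : IsMiddleSelection G Y)
    {q : V} (hq : G.degree q = 3) (hqY : q ∉ Y) {F : Finset V} (hF : ∀ p ∈ F, G.Adj q p ∧ p ∉ Y) :
    F.card ≤ (typeList G q).card := by
  classical
  have hsub : F ⊆ G.neighborFinset q := fun p hp => by simpa using (hF p hp).1
  unfold typeList
  split_ifs with hd
  · obtain ⟨y, hy, hqy⟩ := hY.exists_nbr hd hqY
    have : F ⊆ (G.neighborFinset q).erase y := fun p hp =>
      Finset.mem_erase.2 ⟨fun hh => (hF p hp).2 (hh ▸ hy), hsub hp⟩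
    have := Finset.card_le_card this
    rw [Finset.card_erase_of_mem (by simpa using hqy), SimpleGraph.card_neighborFinset_eq_degree,
      hq] at this
    simpa using this
  · have := Finset.card_le_card hsub
    rw [SimpleGraph.card_neighborFinset_eq_degree, hq] at this
    simpa using this

/-- Any further nonselected neighbor outside `F`, such as a leaf or the far end of a deleted edge,
gives slack. -/
theorem card_lt_typeList {Y : Finset V} (hY : IsMiddleSelection G Y)
    {q : V} (hq : G.degree q = 3) (hqY : q ∉ Y) {F : Finset V} (hF : ∀ p ∈ F, G.Adj q p ∧ p ∉ Y)
    {t : V} (ht : G.Adj q t) (htY : t ∉ Y) (htF : t ∉ F) :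
    F.card < (typeList G q).card := by
  classical
  have := card_le_typeList hY hq hqY (F := insert t F) (by
    intro p hp
    rcases Finset.mem_insert.1 hp with rfl | hp
    exacts [⟨ht, htY⟩, hF p hp])
  rw [Finset.card_insert_of_notMem htF] at this
  omega

/-- The vertices of degree 3 that are not selected. -/
def freeVertices (G : SimpleGraph V) [DecidableRel G.Adj] [DecidableEq V] (Y : Finset V) :
    Finset V := Finset.univ.filter fun v => G.degree v = 3 ∧ v ∉ Y

theorem mem_freeVertices [DecidableEq V] {Y : Finset V} {v : V} :
    v ∈ freeVertices G Y ↔ G.degree v = 3 ∧ v ∉ Y := by simp [freeVertices]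

variable [DecidableEq V]

/-- The graph on the free vertices is connected. -/
theorem freeVertices_subset_of_closed (H : IsTriangleLeafGraph G) (hconn : G.Connected)
    (hK : ∀ x y z w, IsDiamond G x y z w → ¬ G.Adj x w) {Y : Finset V}
    (hY : IsMiddleSelection G Y) {T : Finset V} (hne : T.Nonempty)
    (hcl : ∀ p ∈ T, ∀ q ∈ freeVertices G Y, G.Adj p q → q ∈ T) : freeVertices G Y ⊆ T := by
  obtain ⟨p₀, hp₀⟩ := hne
  -- Adding the removed neighbors of `T` gives a set closed in all of `G`: a leaf has just one
  -- neighbor, and the neighbors of a selected vertex stay connected through the other middle vertex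
  -- `z`.
  let U : Set V := {x | x ∈ T ∨ (x ∉ freeVertices G Y ∧ ∃ p ∈ T, G.Adj x p)}
  have hU : ∀ p ∈ U, ∀ q, G.Adj p q → q ∈ U := by
    rintro p (hp | ⟨hp, t, ht, hpt⟩) q hpq
    · by_cases hq : q ∈ freeVertices G Y
      · exact .inl (hcl p hp q hq hpq)
      · exact .inr ⟨hq, p, hp, hpq.symm⟩
    · left
      rcases H.deg p with hp1 | hp3
      · rwa [H.leaf_unique hp1 hpq hpt]
      · have hpY : p ∈ Y := by
          by_contra hh
          exact hp (mem_freeVertices.2 ⟨hp3, hh⟩)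
        have hfree : ∀ s, G.Adj p s → s ∈ freeVertices G Y := by
          intro s hs
          have := hY.nbr H hK hpY hs
          exact mem_freeVertices.2 ⟨H.degree_of_inDiamond this.2, this.1⟩
        obtain ⟨x, z, w, h⟩ := hY.middle p hpY
        have htr := H.middle_triple h
        have hz : z ∈ T := by
          rcases htr.eq_or hpt with rfl | rfl | rfl
          exacts [hcl _ ht _ (hfree _ htr.adj₂) h.2.2.1, ht,
            hcl _ ht _ (hfree _ htr.adj₂) h.2.2.2.2.2.symm]
        rcases htr.eq_or hpq with rfl | rfl | rfl
        exacts [hcl _ hz _ (hfree _ htr.adj₁) h.2.2.1.symm, hz,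
            hcl _ hz _ (hfree _ htr.adj₃) h.2.2.2.2.2]
  intro q hq
  rcases mem_of_closed hconn hU (Or.inl hp₀) q with h | h
  · exact h
  · exact (h.1 hq).elim

/-- A coloring of the free vertices extends to the selected middle vertices. -/
theorem exists_isTypeColoring_of_free (H : IsTriangleLeafGraph G)
    (hK : ∀ x y z w, IsDiamond G x y z w → ¬ G.Adj x w) {Y : Finset V}
    (hY : IsMiddleSelection G Y) {D : Set (Sym2 V)} (c : V → Fin 3)
    (hc0 : ∀ q ∈ freeVertices G Y, c q ∈ typeList G q)
    (hc : ∀ p ∈ freeVertices G Y, ∀ q ∈ freeVertices G Y, G.Adj p q → s(p, q) ∉ D → c p ≠ c q) :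
    ∃ τ, IsTypeColoring G D τ := by
  have hfree : ∀ p q, q ∈ Y → G.Adj p q → p ∉ Y ∧ c p ≠ 0 := by
    intro p q hq hpq
    obtain ⟨h1, h2⟩ := hY.nbr H hK hq hpq.symm
    exact ⟨h1, ne_zero_of_mem_typeList
      (hc0 p (mem_freeVertices.2 ⟨H.degree_of_inDiamond h2, h1⟩)) h2⟩
  refine ⟨fun v => if v ∈ Y then 0 else c v, fun p q hp hq hpq hD => ?_, fun x y z w h => ?_⟩
  · by_cases hpY : p ∈ Y
    · obtain ⟨h1, h2⟩ := hfree q p hpY hpq.symm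
      simp only [hpY, h1, if_true, if_false]
      exact h2.symm
    · by_cases hqY : q ∈ Y
      · obtain ⟨h1, h2⟩ := hfree p q hqY hpq
        simpa only [hqY, h1, if_true, if_false]
      · simp only [hpY, hqY, if_false]
        exact hc p (mem_freeVertices.2 ⟨hp, hpY⟩) q (mem_freeVertices.2 ⟨hq, hqY⟩) hpq hD
  · have hx := hY.end_not_mem H hK h
    simp only [hx, if_false]
    exact ne_zero_of_mem_typeList
      (hc0 x (mem_freeVertices.2 ⟨H.degree_of_inDiamond h.inDiamond₁, hx⟩)) h.inDiamond₁

/-- Without an outer edge, the free vertices can be colored greedily. -/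
theorem exists_free_coloring_off_edge (H : IsTriangleLeafGraph G) (hconn : G.Connected)
    (hK : ∀ x y z w, IsDiamond G x y z w → ¬ G.Adj x w) {Y : Finset V}
    (hY : IsMiddleSelection G Y) {u v : V} (huv : OuterAdj G u v) :
    ∃ c : V → Fin 3, (∀ q ∈ freeVertices G Y, c q ∈ typeList G q) ∧
      ∀ p ∈ freeVertices G Y, ∀ q ∈ freeVertices G Y, G.Adj p q ∧ s(p, q) ≠ s(u, v) → c p ≠ c q := by
  have huY := hY.not_mem_of_outerAdj H huv
  have hvY := hY.not_mem_of_outerAdj H huv.symm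
  have hsub : ∀ q, ∀ p ∈ (freeVertices G Y).filter (fun p => G.Adj q p ∧ s(q, p) ≠ s(u, v)),
      G.Adj q p ∧ p ∉ Y := by
    intro q p hp
    obtain ⟨h1, h2⟩ := Finset.mem_filter.1 hp
    exact ⟨h2.1, (mem_freeVertices.1 h1).2⟩
  refine exists_list_coloring_of_slack (fun p q => G.Adj p q ∧ s(p, q) ≠ s(u, v))
    (fun p q h => ⟨h.1.symm, by rw [Sym2.eq_swap]; exact h.2⟩) (fun p h => h.1.ne rfl)
    (typeList G) (freeVertices G Y) (fun q hq => ?_) (fun T hT hne hcl => ?_)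
  · obtain ⟨h1, h2⟩ := mem_freeVertices.1 hq
    exact card_le_typeList hY h1 h2 (hsub q)
  · by_cases huT : u ∈ T
    · obtain ⟨h1, h2⟩ := mem_freeVertices.1 (hT huT)
      exact ⟨u, huT, card_lt_typeList hY h1 h2 (hsub u) huv.1 hvY
        fun hh => (Finset.mem_filter.1 hh).2.2 rfl⟩
    by_cases hvT : v ∈ T
    · obtain ⟨h1, h2⟩ := mem_freeVertices.1 (hT hvT)
      exact ⟨v, hvT, card_lt_typeList hY h1 h2 (hsub v) huv.1.symm huY
        fun hh => (Finset.mem_filter.1 hh).2.2 Sym2.eq_swap⟩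
    exfalso
    -- A closed set missing both ends of the deleted edge is also closed with that edge present, so
    -- it contains all free vertices, including at least one of those ends.
    have hall := freeVertices_subset_of_closed H hconn hK hY hne (fun p hp q hq hpq => by
      refine hcl p hp q hq ⟨hpq, fun he => ?_⟩
      rcases Sym2.eq_iff.1 he with ⟨rfl, _⟩ | ⟨rfl, _⟩
      exacts [huT hp, hvT hp])
    rcases H.deg u with hu | hu
    · exact hvT (hall (mem_freeVertices.2 ⟨H.leaf u v huv.1 hu, hvY⟩))
    · exact huT (hall (mem_freeVertices.2 ⟨hu, huY⟩))

omit [DecidableEq V] in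
theorem exists_isTypeColoring_off_edge (H : IsTriangleLeafGraph G) (hconn : G.Connected)
    (hK : ∀ x y z w, IsDiamond G x y z w → ¬ G.Adj x w) {u v : V} (huv : OuterAdj G u v) :
    ∃ τ, IsTypeColoring G {s(u, v)} τ := by
  classical
  obtain ⟨Y, hY⟩ := exists_isMiddleSelection H hK
  obtain ⟨c, hc0, hc⟩ := exists_free_coloring_off_edge H hconn hK hY huv
  exact exists_isTypeColoring_of_free H hK hY c hc0 fun p hp q hq h hD => hc p hp q hq ⟨h, hD⟩

omit [DecidableEq V] in
/-- A vertex outside the diamonds that is adjacent to a diamond makes a type coloring possible. -/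
theorem exists_isTypeColoring_of_adj_diamond (H : IsTriangleLeafGraph G) (hconn : G.Connected)
    (hK : ∀ x y z w, IsDiamond G x y z w → ¬ G.Adj x w) {x v : V} (hv : G.degree v = 3)
    (hvd : ¬ InDiamond G v) (hx : InDiamond G x) (hxv : G.Adj x v) :
    ∃ τ, IsTypeColoring G ∅ τ := by
  classical
  obtain ⟨Y, hY⟩ := exists_isMiddleSelection H hK
  have hxv : OuterAdj G x v :=
    (innerAdj_or_outerAdj hxv).resolve_left fun hi => hvd (H.inDiamond_of_innerAdj hx hi)
  have hx3 := H.degree_of_inDiamond hx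
  have hxY := hY.not_mem_of_outerAdj H hxv
  have hvY := hY.not_mem_of_outerAdj H hxv.symm
  obtain ⟨a, b, x', ht, hab, ho⟩ := H.exists_triangle_of_not_inDiamond hv hvd
  obtain rfl := H.outerAdj_unique ho hxv.symm
  have iva : InnerAdj G v a := ⟨ht.adj₁, b, ht.adj₂, hab⟩
  have ivb : InnerAdj G v b := ⟨ht.adj₂, a, ht.adj₁, hab.symm⟩
  have had : ¬ InDiamond G a := fun hh => hvd (H.inDiamond_of_innerAdj hh iva.symm)
  have hbd : ¬ InDiamond G b := fun hh => hvd (H.inDiamond_of_innerAdj hh ivb.symm)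
  have hYd : ∀ p, ¬ InDiamond G p → p ∉ Y := by
    intro p hp hpY
    obtain ⟨_, _, _, h⟩ := hY.middle p hpY
    exact hp h.inDiamond₂
  have hvS : v ∈ freeVertices G Y := mem_freeVertices.2 ⟨hv, hvY⟩
  have haS : a ∈ freeVertices G Y :=
    mem_freeVertices.2 ⟨H.degree_of_innerAdj iva.symm, hYd a had⟩
  have hbS : b ∈ freeVertices G Y :=
    mem_freeVertices.2 ⟨H.degree_of_innerAdj ivb.symm, hYd b hbd⟩
  have hxS : x' ∈ freeVertices G Y := mem_freeVertices.2 ⟨hx3, hxY⟩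
  -- Does removing `v` separate its triangle from the diamond vertex `x'` in the free graph?
  by_cases hT : ∃ T ⊆ (freeVertices G Y).erase v,
      (∀ p ∈ T, ∀ q ∈ (freeVertices G Y).erase v, G.Adj p q → q ∈ T) ∧ a ∈ T ∧ x' ∉ T
  · -- the edge is a bridge of the graph on the free vertices
    obtain ⟨T, hTS, hTc, haT, hxT⟩ := hT
    have hbT : b ∈ T := hTc a haT b (Finset.mem_erase.2 ⟨ht.adj₂.ne', hbS⟩) hab
    obtain ⟨c, hc0, hc⟩ := exists_free_coloring_off_edge H hconn hK hY hxv
    by_cases hne : c x' = c v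
    · have hcx := ne_zero_of_mem_typeList (hc0 x' hxS) hx
      let σ := Equiv.swap (1 : Fin 3) 2
      have hσlist : ∀ q ∈ freeVertices G Y, σ (c q) ∈ typeList G q := by
        intro q hq
        have := hc0 q hq
        revert this
        unfold typeList
        split_ifs
        · generalize c q = s
          revert s; decide
        · simp
      have hcut : ∀ p q, (p ∈ T ∨ p = v) → ¬ (q ∈ T ∨ q = v) → q ∈ freeVertices G Y → G.Adj p q →
          σ (c p) ≠ c q := by
        intro p q hp hq hqS hpq
        push Not at hq
        rcases hp with hp | rfl
        · exact (hq.1 (hTc p hp q (Finset.mem_erase.2 ⟨hq.2, hqS⟩) hpq)).elim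
        · rcases ht.eq_or hpq with rfl | rfl | rfl
          · exact (hq.1 haT).elim
          · exact (hq.1 hbT).elim
          · rw [← hne]
            revert hcx
            generalize c q = s
            revert s; decide
      refine exists_isTypeColoring_of_free H hK hY
        (fun p => if p ∈ T ∨ p = v then σ (c p) else c p) (fun q hq => ?_) (fun p hp q hq hpq _ => ?_)
      · split_ifs
        exacts [hσlist q hq, hc0 q hq]
      · by_cases h1 : p ∈ T ∨ p = v <;> by_cases h2 : q ∈ T ∨ q = v
        · rw [if_pos h1, if_pos h2]
          refine fun hh => hc p hp q hq ⟨hpq, fun he => ?_⟩ (σ.injective hh)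
          have hx' : ¬ (x' ∈ T ∨ x' = v) := by
            push Not
            exact ⟨hxT, hxv.1.ne⟩
          rcases Sym2.eq_iff.1 he with ⟨rfl, _⟩ | ⟨_, rfl⟩
          exacts [hx' h1, hx' h2]
        · rw [if_pos h1, if_neg h2]
          exact hcut p q h1 h2 hq hpq
        · rw [if_neg h1, if_pos h2]
          exact (hcut q p h2 h1 hp hpq.symm).symm
        · rw [if_neg h1, if_neg h2]
          refine hc p hp q hq ⟨hpq, fun he => ?_⟩
          rcases Sym2.eq_iff.1 he with ⟨_, rfl⟩ | ⟨rfl, _⟩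
          exacts [h2 (.inr rfl), h1 (.inr rfl)]
    · refine exists_isTypeColoring_of_free H hK hY c hc0 fun p hp q hq hpq _ => ?_
      by_cases he : s(p, q) = s(x', v)
      · rcases Sym2.eq_iff.1 he with ⟨rfl, rfl⟩ | ⟨rfl, rfl⟩
        exacts [hne, Ne.symm hne]
      · exact hc p hp q hq ⟨hpq, he⟩
  · -- color `v` with 0 and the other free vertices greedily
    push Not at hT
    -- Type 0 at `v` costs `a` and `b` one type each, matching the loss of the neighbor `v`. It
    -- costs `x'` nothing, since its list lacked 0 already, and this yields the slack.
    let L : V → Finset (Fin 3) := fun q => if G.Adj q v then {1, 2} else typeList G q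
    have hsub : ∀ q, ∀ p ∈ ((freeVertices G Y).erase v).filter (fun p => G.Adj q p),
        G.Adj q p ∧ p ∉ Y := by
      intro q p hp
      obtain ⟨h1, h2⟩ := Finset.mem_filter.1 hp
      exact ⟨h2, (mem_freeVertices.1 (Finset.mem_of_mem_erase h1)).2⟩
    have hvF : ∀ q, v ∉ ((freeVertices G Y).erase v).filter (fun p => G.Adj q p) := by
      intro q hh
      exact Finset.notMem_erase _ _ (Finset.mem_filter.1 hh).1
    have htl : ∀ q, ¬ InDiamond G q → (typeList G q).card = 3 := by
      intro q hq
      rw [typeList, if_neg hq]; rfl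
    have htlx : (typeList G x').card = 2 := by
      rw [typeList, if_pos hx]; rfl
    have hslack : (((freeVertices G Y).erase v).filter (fun p => G.Adj x' p)).card < (L x').card := by
      have := card_lt_typeList hY hx3 hxY (hsub x') hxv.1 hvY (hvF x')
      simp only [L]
      rw [if_pos hxv.1]
      rw [htlx] at this
      exact this
    obtain ⟨c, hc0, hc⟩ := exists_list_coloring_of_slack (fun p q => G.Adj p q)
      (fun p q h => h.symm) (fun p h => h.ne rfl) L ((freeVertices G Y).erase v) (by
        intro q hq
        obtain ⟨h1, h2⟩ := mem_freeVertices.1 (Finset.mem_of_mem_erase hq)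
        by_cases hqv : G.Adj q v
        · rcases ht.eq_or hqv.symm with rfl | rfl | rfl
          · have := card_lt_typeList hY h1 h2 (hsub q) hqv hvY (hvF q)
            rw [htl q had] at this
            simp only [L]
            rw [if_pos hqv]
            exact Nat.lt_succ_iff.1 this
          · have := card_lt_typeList hY h1 h2 (hsub q) hqv hvY (hvF q)
            rw [htl q hbd] at this
            simp only [L]
            rw [if_pos hqv]
            exact Nat.lt_succ_iff.1 this
          · exact hslack.le
        · simp only [L]
          rw [if_neg hqv]
          exact card_le_typeList hY h1 h2 (hsub q)) (by
        intro T hTS hne hTc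
        have haT' : a ∈ T → x' ∈ T := hT T hTS hTc
        refine ⟨x', ?_, hslack⟩
        by_contra hxT
        have haT : a ∉ T := fun hh => hxT (haT' hh)
        have hbT : b ∉ T := fun hh => haT
          (hTc b hh a (Finset.mem_erase.2 ⟨ht.adj₁.ne', haS⟩) hab.symm)
        -- Missing all three neighbors of `v`, the set would be closed even with `v` restored, and
        -- so would contain `v`.
        have hall := freeVertices_subset_of_closed H hconn hK hY hne (fun p hp q hq hpq => by
            refine hTc p hp q (Finset.mem_erase.2 ⟨?_, hq⟩) hpq
            rintro rfl
            rcases ht.eq_or hpq.symm with rfl | rfl | rfl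
            exacts [haT hp, hbT hp, hxT hp])
        exact Finset.notMem_erase _ _ (hTS (hall hvS)))
    have hcv : ∀ q ∈ freeVertices G Y, G.Adj q v → c q ≠ 0 := by
      intro q hq hqv
      have := hc0 q (Finset.mem_erase.2 ⟨hqv.ne, hq⟩)
      simp only [L] at this
      rw [if_pos hqv] at this
      revert this
      generalize c q = s
      revert s; decide
    refine exists_isTypeColoring_of_free H hK hY (Function.update c v 0) (fun q hq => ?_)
      (fun p hp q hq hpq _ => ?_)
    · by_cases hqv : q = v
      · subst hqv
        rw [typeList, if_neg hvd]
        exact Finset.mem_univ _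
      · rw [Function.update_of_ne hqv]
        have := hc0 q (Finset.mem_erase.2 ⟨hqv, hq⟩)
        simp only [L] at this
        split_ifs at this with hadj
        · unfold typeList
          split_ifs
          exacts [this, Finset.mem_univ _]
        · exact this
    · by_cases hpv : p = v
      · subst hpv
        rw [Function.update_self, Function.update_of_ne hpq.ne']
        exact (hcv q hq hpq.symm).symm
      · by_cases hqv : q = v
        · subst hqv
          rw [Function.update_self, Function.update_of_ne hpq.ne]
          exact hcv p hp hpq
        · rw [Function.update_of_ne hpv, Function.update_of_ne hqv]
          exact hc p (Finset.mem_erase.2 ⟨hpv, hp⟩) q (Finset.mem_erase.2 ⟨hqv, hq⟩) hpq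

end Greedy

end ColorBlind
namespace ColorBlind

/-! ### Double counting in cycles of diamonds. -/

section Counting

variable {V : Type*} {G : SimpleGraph V} [Fintype V] [DecidableRel G.Adj]

theorem NbrTriple.card_filter {p a b c : V} (h : NbrTriple G p a b c) (P : V → Prop)
    [DecidablePred P] :
    ((Finset.univ.filter P).filter (G.Adj p)).card =
      (if P a then 1 else 0) + ((if P b then 1 else 0) + (if P c then 1 else 0)) := by
  classical
  have : (Finset.univ.filter P).filter (G.Adj p) = ({a, b, c} : Finset V).filter P := by
    ext q
    simp [h.2.2.2 q, and_comm]
  rw [this, Finset.card_filter, Finset.sum_insert (by simp [h.1, h.2.1]),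
    Finset.sum_insert (by simp [h.2.2.1]), Finset.sum_singleton]

theorem sum_card_nbrs_comm (P Q : V → Prop) [DecidablePred P] [DecidablePred Q] :
    ∑ p ∈ Finset.univ.filter P, ((Finset.univ.filter Q).filter (G.Adj p)).card =
      ∑ q ∈ Finset.univ.filter Q, ((Finset.univ.filter P).filter (G.Adj q)).card := by
  have := Finset.sum_card_bipartiteAbove_eq_sum_card_bipartiteBelow (s := Finset.univ.filter P)
    (t := Finset.univ.filter Q) G.Adj
  simpa only [Finset.bipartiteAbove, Finset.bipartiteBelow, G.adj_comm] using this

/-- Graphs all of whose vertices are in diamonds, and a type coloring that is proper on the inner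
edges. -/
structure IsDiamondTypeColoring (G : SimpleGraph V) [DecidableRel G.Adj] (D : Set (Sym2 V))
    (τ : V → Fin 3) : Prop extends IsTypeColoring G D τ where
  graph : IsTriangleLeafGraph G
  not_adj : ∀ x y z w, IsDiamond G x y z w → ¬ G.Adj x w
  inDiamond : ∀ v, InDiamond G v
  inner : ∀ u v, InnerAdj G u v → s(u, v) ∉ D

namespace IsDiamondTypeColoring

variable {D : Set (Sym2 V)} {τ : V → Fin 3} (h : IsDiamondTypeColoring G D τ)
include h

theorem degree (v : V) : G.degree v = 3 := h.graph.degree_of_inDiamond (h.inDiamond v)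

theorem inner_ne {u v : V} (huv : InnerAdj G u v) : τ u ≠ τ v :=
  h.proper u v (h.degree u) (h.degree v) huv.1 (h.inner u v huv)

theorem outer_ne_zero {u v : V} (huv : OuterAdj G u v) : τ u ≠ 0 :=
  fun h0 => h.not_inDiamond h.graph huv h0 (h.inDiamond u)

theorem nbr_of_zero {p q : V} (hp : τ p = 0) (hpq : G.Adj p q) : τ q ≠ 0 := by
  rcases innerAdj_or_outerAdj hpq with hi | ho
  · exact fun hq => h.inner_ne hi (hp.trans hq.symm)
  · exact (h.outer_ne_zero ho hp).elim

/-- In a diamond the types are 0 and a nonzero type on the middle vertices and the remaining type on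
both ends. The only neighbor of undetermined type is the one across the outer edge of an end, and it
is not 0. -/
theorem exists_nbrs {p : V} (hp : τ p ≠ 0) :
    ∃ a b c, NbrTriple G p a b c ∧ τ a = 0 ∧ τ b ≠ 0 ∧ τ b ≠ τ p ∧ τ c ≠ 0 := by
  rcases (h.inDiamond p).end_or_middle with ⟨y, z, w, hD⟩ | ⟨x, z, w, hD⟩
  · obtain ⟨p', ht, ho⟩ := h.graph.end_outerAdj hD (h.not_adj _ _ _ _ hD)
    have e1 := h.inner_ne ⟨ht.adj₁, z, ht.adj₂, hD.2.2.2.1⟩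
    have e2 := h.inner_ne ⟨ht.adj₂, y, ht.adj₁, hD.2.2.2.1.symm⟩
    have e3 := h.inner_ne ⟨hD.2.2.2.1, p, ht.adj₁.symm, ht.adj₂.symm⟩
    have e4 := h.outer_ne_zero ho.symm
    have : τ y = 0 ∨ τ z = 0 := by omega
    rcases this with h0 | h0
    · exact ⟨y, z, p', ht, h0, by omega, by omega, e4⟩
    · exact ⟨z, y, p', ht.swap, h0, by omega, by omega, e4⟩
  · have ht := h.graph.middle_triple hD
    have e1 := h.inner_ne ⟨ht.adj₁, z, ht.adj₂, hD.2.2.1⟩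
    have e2 := h.inner_ne ⟨ht.adj₂, x, ht.adj₁, hD.2.2.1.symm⟩
    have e3 := h.inner_ne ⟨hD.2.2.1, p, ht.adj₁.symm, ht.adj₂.symm⟩
    have e4 := h.diamond _ _ _ _ hD
    have e5 := h.diamond _ _ _ _ hD.symm
    exact ⟨z, x, w, ht.swap, by omega, e4, e1.symm, e5⟩

/-- Count the edges at type-0 vertices from both sides: three at each of these, one at each other
vertex. -/
theorem card_ne_zero :
    (Finset.univ.filter fun v => τ v ≠ 0).card = 3 * (Finset.univ.filter fun v => τ v = 0).card := by
  have key := sum_card_nbrs_comm (G := G) (fun v => τ v = 0) (fun v => τ v ≠ 0)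
  rw [Finset.sum_congr rfl (g := fun _ => 3), Finset.sum_congr (s₁ := Finset.univ.filter
    fun v => τ v ≠ 0) rfl (g := fun _ => 1)] at key
  · simp only [Finset.sum_const, smul_eq_mul] at key
    omega
  · intro p hp
    obtain ⟨a, b, c, ht, ha, hb, -, hc⟩ := h.exists_nbrs (Finset.mem_filter.1 hp).2
    rw [ht.card_filter]
    simp [ha, hb, hc]
  · intro p hp
    have hp0 := (Finset.mem_filter.1 hp).2
    obtain ⟨a, b, c, ht⟩ := exists_nbrTriple_of_degree (h.degree p)
    rw [ht.card_filter]
    simp [h.nbr_of_zero hp0 ht.adj₁, h.nbr_of_zero hp0 ht.adj₂, h.nbr_of_zero hp0 ht.adj₃]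

theorem card_eq : Fintype.card V = 4 * (Finset.univ.filter fun v => τ v = 0).card := by
  have h1 := h.card_ne_zero
  have h2 : (Finset.univ.filter fun v => τ v = 0).card +
      (Finset.univ.filter fun v => τ v ≠ 0).card = Fintype.card V := by
    rw [← Finset.card_univ, ← Finset.card_filter_add_card_filter_not (s := (Finset.univ : Finset V))
      (fun v => τ v = 0)]
  omega

theorem card_add_card {s t : Fin 3} (hs : s ≠ 0) (ht : t ≠ 0) (hst : s ≠ t) :
    (Finset.univ.filter fun v => τ v = s).card + (Finset.univ.filter fun v => τ v = t).card =
      3 * (Finset.univ.filter fun v => τ v = 0).card := by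
  classical
  rw [← h.card_ne_zero, ← Finset.card_union_of_disjoint]
  · congr 1
    ext v
    simp only [Finset.mem_union, Finset.mem_filter, Finset.mem_univ, true_and]
    omega
  · refine Finset.disjoint_left.2 fun v h1 h2 => hst ?_
    rw [← (Finset.mem_filter.1 h1).2, (Finset.mem_filter.1 h2).2]

/-- Exactly two of the three neighbors of a vertex of nonzero type have nonzero type. -/
theorem sum_nbrs {s t : Fin 3} (hs : s ≠ 0) (ht : t ≠ 0) (hst : s ≠ t) :
    ∑ p ∈ Finset.univ.filter (fun v => τ v = s),
        ((Finset.univ.filter fun v => τ v = t).filter (G.Adj p)).card +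
      ∑ p ∈ Finset.univ.filter (fun v => τ v = s),
        ((Finset.univ.filter fun v => τ v = s).filter (G.Adj p)).card =
      2 * (Finset.univ.filter fun v => τ v = s).card := by
  rw [← Finset.sum_add_distrib, Finset.sum_congr rfl (g := fun _ => 2)]
  · simp [mul_comm]
  · intro p hp
    have hp := (Finset.mem_filter.1 hp).2
    obtain ⟨a, b, c, htr, ha, hb, hbp, hc⟩ := h.exists_nbrs (hp ▸ hs)
    rw [htr.card_filter, htr.card_filter]
    have e1 : τ b = t := by omega
    have e2 : τ c = s ∨ τ c = t := by omega
    rcases e2 with e2 | e2 <;> simp [ha, e1, e2, hs.symm, ht.symm, hst, hst.symm]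

theorem sum_nbrs_self {s : Fin 3}
    (hD : ∀ p q, τ p = s → τ q = s → s(p, q) ∉ D) :
    ∑ p ∈ Finset.univ.filter (fun v => τ v = s),
        ((Finset.univ.filter fun v => τ v = s).filter (G.Adj p)).card = 0 := by
  refine Finset.sum_eq_zero fun p hp => ?_
  rw [Finset.card_eq_zero, Finset.filter_eq_empty_iff]
  intro q hq hpq
  have hp := (Finset.mem_filter.1 hp).2
  have hq := (Finset.mem_filter.1 hq).2
  exact h.proper p q (h.degree p) (h.degree q) hpq (hD p q hp hq) (hp.trans hq.symm)

end IsDiamondTypeColoring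

/-- Edges between types 1 and 2 number twice each class, so the classes are equal in size; their sum
is three times the number of type-0 vertices. -/
theorem IsDiamondTypeColoring.even {τ : V → Fin 3} (h : IsDiamondTypeColoring G ∅ τ) :
    Even (Finset.univ.filter fun v => τ v = 0).card := by
  have h1 := h.sum_nbrs (s := 1) (t := 2) (by decide) (by decide) (by decide)
  have h2 := h.sum_nbrs (s := 2) (t := 1) (by decide) (by decide) (by decide)
  have h3 := h.sum_nbrs_self (s := 1) (by simp)
  have h4 := h.sum_nbrs_self (s := 2) (by simp)
  have h5 := sum_card_nbrs_comm (G := G) (fun v => τ v = 1) (fun v => τ v = 2)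
  have h6 := h.card_add_card (s := 1) (t := 2) (by decide) (by decide) (by decide)
  rw [Nat.even_iff]
  omega

/-- The one bad edge makes its class larger than the other by exactly one, so three times the number
of type-0 vertices is odd. -/
theorem IsDiamondTypeColoring.odd {τ : V → Fin 3} {u v : V}
    (h : IsDiamondTypeColoring G {s(u, v)} τ) (huv : OuterAdj G u v) (heq : τ u = τ v) :
    Odd (Finset.univ.filter fun v => τ v = 0).card := by
  classical
  have hu := h.outer_ne_zero huv
  obtain ⟨t, ht, htu⟩ : ∃ t : Fin 3, t ≠ 0 ∧ τ u ≠ t := by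
    generalize τ u = s
    revert s; decide
  have h1 := h.sum_nbrs hu ht htu
  have h2 := h.sum_nbrs ht hu htu.symm
  have h4 := h.sum_nbrs_self (s := t) (by
    intro p q hp hq he
    rcases Sym2.eq_iff.1 he with ⟨rfl, rfl⟩ | ⟨rfl, rfl⟩
    exacts [htu hp, htu hq])
  -- The bad edge is the only one within its class, and it is counted once from each end.
  have h3 : ∑ p ∈ Finset.univ.filter (fun v => τ v = τ u),
      ((Finset.univ.filter fun v => τ v = τ u).filter (G.Adj p)).card = 2 := by
    have hval : ∀ p ∈ Finset.univ.filter (fun v => τ v = τ u),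
        ((Finset.univ.filter fun v => τ v = τ u).filter (G.Adj p)).card =
          if p ∈ ({u, v} : Finset V) then 1 else 0 := by
      intro p hp
      have hp := (Finset.mem_filter.1 hp).2
      have hq : ∀ q ∈ (Finset.univ.filter fun v => τ v = τ u).filter (G.Adj p),
          s(p, q) = s(u, v) := by
        intro q hq
        obtain ⟨hq, hpq⟩ := Finset.mem_filter.1 hq
        have hq := (Finset.mem_filter.1 hq).2
        by_contra hne
        exact h.proper p q (h.degree p) (h.degree q) hpq hne (hp.trans hq.symm)
      split_ifs with hmem
      · rw [Finset.mem_insert, Finset.mem_singleton] at hmem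
        rw [Finset.card_eq_one]
        rcases hmem with rfl | rfl
        · refine ⟨v, Finset.eq_singleton_iff_unique_mem.2 ⟨?_, fun q hq' => ?_⟩⟩
          · simp [heq, huv.1]
          · exact Sym2.congr_right.1 (hq q hq')
        · refine ⟨u, Finset.eq_singleton_iff_unique_mem.2 ⟨?_, fun q hq' => ?_⟩⟩
          · simp [huv.1.symm]
          · have := hq q hq'
            rw [Sym2.eq_swap (a := u)] at this
            exact Sym2.congr_right.1 this
      · rw [Finset.card_eq_zero, Finset.eq_empty_iff_forall_notMem]
        intro q hq'
        rw [Finset.mem_insert, Finset.mem_singleton] at hmem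
        rcases Sym2.eq_iff.1 (hq q hq') with ⟨rfl, _⟩ | ⟨rfl, _⟩
        exacts [hmem (.inl rfl), hmem (.inr rfl)]
    rw [Finset.sum_congr rfl hval, ← Finset.card_filter]
    have : (Finset.univ.filter (fun v => τ v = τ u)).filter (fun p => p ∈ ({u, v} : Finset V)) =
        {u, v} := by
      ext p
      simp only [Finset.mem_filter, Finset.mem_univ, true_and, Finset.mem_insert,
        Finset.mem_singleton]
      constructor
      · exact fun hh => hh.2
      · rintro (rfl | rfl)
        exacts [⟨rfl, .inl rfl⟩, ⟨heq.symm, .inr rfl⟩]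
    rw [this, Finset.card_pair huv.1.ne]
  have h5 := sum_card_nbrs_comm (G := G) (fun v => τ v = τ u) (fun v => τ v = t)
  have h6 := h.card_add_card hu ht htu
  rw [Nat.odd_iff]
  omega

end Counting

/-! ### Existence of type colorings. -/

section Main

variable {V : Type*} {G : SimpleGraph V} [Fintype V] [DecidableRel G.Adj]

/-- A connected graph containing a diamond with adjacent ends is an odd cycle of diamonds. -/
theorem isOddCycleOfDiamonds_of_adj (H : IsTriangleLeafGraph G) (hconn : G.Connected)
    {x y z w : V} (h : IsDiamond G x y z w) (hxw : G.Adj x w) : IsOddCycleOfDiamonds G := by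
  classical
  obtain ⟨hne, hxy, hxz, hyz, hyw, hzw⟩ := id h
  have tx := nbrTriple_of_adj (H.degree_eq_three hxy hxz hyz.ne) hxy hxz hxw hyz.ne hyw.ne hzw.ne
  have ty := H.middle_triple h
  have tz := H.middle_triple h.swap
  have tw := nbrTriple_of_adj (H.degree_eq_three hyw.symm hzw.symm hyz.ne) hyw.symm hzw.symm
    hxw.symm hyz.ne hxy.ne' hxz.ne'
  have hall : ∀ v, v = x ∨ v = y ∨ v = z ∨ v = w := by
    intro v
    refine mem_of_closed hconn (U := {v | v = x ∨ v = y ∨ v = z ∨ v = w}) ?_ (.inl rfl) v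
    rintro p (rfl | rfl | rfl | rfl) q hpq
    · rcases tx.eq_or hpq with rfl | rfl | rfl <;> simp
    · rcases ty.eq_or hpq with rfl | rfl | rfl <;> simp
    · rcases tz.eq_or hpq with rfl | rfl | rfl <;> simp
    · rcases tw.eq_or hpq with rfl | rfl | rfl <;> simp
  have hd : ∀ v, InDiamond G v := fun v => ⟨x, y, z, w, h, hall v⟩
  refine ⟨⟨fun v => H.degree_of_inDiamond (hd v), hd⟩, 1, odd_one, ?_⟩
  have : (Finset.univ : Finset V) = {x, y, z, w} := by
    ext v; simpa using hall v
  rw [← Finset.card_univ, this, Finset.card_insert_of_notMem, Finset.card_insert_of_notMem,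
    Finset.card_pair hzw.ne]
  · simp [hyz.ne, hyw.ne]
  · simp [hxy.ne, hxz.ne, hne]

theorem exists_isTypeColoring (H : IsTriangleLeafGraph G) (hconn : G.Connected)
    (hG : ¬ IsOddCycleOfDiamonds G) : ∃ τ, IsTypeColoring G ∅ τ := by
  classical
  have hK : ∀ x y z w, IsDiamond G x y z w → ¬ G.Adj x w :=
    fun x y z w h hxw => hG (isOddCycleOfDiamonds_of_adj H hconn h hxw)
  by_cases hleaf : ∃ u, G.degree u = 1
  · obtain ⟨u, hu⟩ := hleaf
    obtain ⟨v, huv⟩ := (G.degree_pos_iff_exists_adj u).1 (by omega)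
    obtain ⟨τ, hτ⟩ := exists_isTypeColoring_off_edge H hconn hK (H.outerAdj_of_leaf hu huv)
    exact ⟨τ, hτ.of_ne fun hu3 => by omega⟩
  have hreg : ∀ v, G.degree v = 3 := fun v => (H.deg v).resolve_left fun h => hleaf ⟨v, h⟩
  by_cases hall : ∀ v, InDiamond G v
  · obtain ⟨v₀⟩ := hconn.nonempty
    obtain ⟨x, y, z, w, hD, _⟩ := hall v₀
    obtain ⟨x', _, ho⟩ := H.end_outerAdj hD (hK _ _ _ _ hD)
    obtain ⟨τ, hτ⟩ := exists_isTypeColoring_off_edge H hconn hK ho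
    refine ⟨τ, hτ.of_ne fun _ _ heq => hG ?_⟩
    have hDC : IsDiamondTypeColoring G {s(x, x')} τ := by
      refine ⟨hτ, H, hK, hall, fun u v huv he => ?_⟩
      rcases Sym2.eq_iff.1 he with ⟨rfl, rfl⟩ | ⟨rfl, rfl⟩
      exacts [huv.not_outerAdj ho, huv.symm.not_outerAdj ho]
    exact ⟨⟨hreg, hall⟩, _, hDC.odd ho heq, hDC.card_eq⟩
  push Not at hall
  obtain ⟨v, hv⟩ := hall
  by_cases hdia : ∃ x, InDiamond G x
  · obtain ⟨x, hx⟩ := hdia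
    obtain ⟨p, hp, q, hpq, hq⟩ : ∃ p, InDiamond G p ∧ ∃ q, G.Adj p q ∧ ¬ InDiamond G q := by
      by_contra! hcon
      exact hv (mem_of_closed hconn (U := {p | InDiamond G p}) hcon hx v)
    exact exists_isTypeColoring_of_adj_diamond H hconn hK (hreg q) hq hp hpq
  · push Not at hdia
    have hdia' : ∀ x y z w, ¬ IsDiamond G x y z w := fun x y z w h => hdia x h.inDiamond₁
    obtain ⟨a, b, u, _, _, ho⟩ := H.exists_triangle_of_not_inDiamond (hreg v) hv
    obtain ⟨τ, hτ⟩ := exists_isTypeColoring_off_edge H hconn hK ho.symm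
    by_cases heq : τ u = τ v
    · have hτ' := hτ.comp (Equiv.swap (τ v) 0) fun x y z w h => (hdia' x y z w h).elim
      obtain ⟨τ', h', _⟩ := hτ'.exists_kempe_swap H ho.symm (hreg v) (by simp)
        (fun _ => by simp [heq])
      exact ⟨τ', h'⟩
    · exact ⟨τ, hτ.of_ne fun _ _ => heq⟩

/-- At a vertex of type 0 the chain exchange applies to the leaf edge, as no condition is imposed at
the leaf. Otherwise exchanging 1 and 2 everywhere keeps the ends of diamonds nonzero. -/
theorem exists_isTypeColoring_ne (H : IsTriangleLeafGraph G) {τ : V → Fin 3}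
    (hτ : IsTypeColoring G ∅ τ) {u v : V} (huv : G.Adj u v) (hu : G.degree u = 1)
    (hv : G.degree v = 3) : ∃ τ', IsTypeColoring G ∅ τ' ∧ τ' v ≠ τ v := by
  by_cases h0 : τ v = 0
  · obtain ⟨τ', h', h1⟩ := IsTypeColoring.exists_kempe_swap H (H.outerAdj_of_leaf hu huv) hv
      (τ := τ) ⟨fun p q hp hq hpq _ => hτ.proper p q hp hq hpq (by simp), hτ.diamond⟩ h0
      (fun h3 => by omega)
    exact ⟨τ', h', by rw [h1, h0]; decide⟩
  · refine ⟨_, hτ.comp (Equiv.swap 1 2) fun x y z w h => ?_, ?_⟩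
    · have := hτ.diamond x y z w h
      revert this
      generalize τ x = s
      revert s; decide
    · rw [Function.comp_apply]
      revert h0
      generalize τ v = s
      revert s; decide

/-! ### The parity obstruction and the main results. -/

omit [Fintype V] [DecidableRel G.Adj] in
theorem edgeOf_symm {u v : V} (h : G.Adj u v) : edgeOf h.symm = edgeOf h :=
  Subtype.ext Sym2.eq_swap

theorem tripleType_eq_zero_iff {α : Type*} [DecidableEq α] {p q r : α} :
    tripleType p q r = 0 ↔ p = q ∧ q = r := by
  unfold tripleType
  split_ifs <;> simp_all

/-- The vertex types of a distinguishing coloring of a cycle of diamonds form a type coloring. -/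
theorem IsColorBlindDistinguishing.isDiamondTypeColoring (H : IsTriangleLeafGraph G)
    (hall : ∀ v, InDiamond G v) {k : ℕ} {c : G.EdgeLabeling (Fin k)}
    (hc : IsColorBlindDistinguishing c) : IsDiamondTypeColoring G ∅ (vertexType c) := by
  have hdeg : ∀ v, G.degree v = 3 := fun v => H.degree_of_inDiamond (hall v)
  have hproper : ∀ u v, G.Adj u v → vertexType c u ≠ vertexType c v := fun u v huv heq =>
    hc u v huv ((colorBlindPartition_eq_iff_vertexType c c (hdeg u) (hdeg v)).2 heq)
  refine ⟨⟨fun u v _ _ huv _ => hproper u v huv, fun x y z w h hx0 => ?_⟩, H,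
    fun x y z w h hxw => ?_, hall, fun _ _ _ => Set.notMem_empty _⟩
  · obtain ⟨x', tx⟩ := H.end_triple h
    obtain ⟨w', tw⟩ := H.end_triple h.symm
    have ty := H.middle_triple h
    have tz := H.middle_triple h.swap
    have e1 := hproper _ _ tx.adj₁
    have e2 := hproper _ _ tx.adj₂
    have e3 := hproper _ _ ty.adj₂
    have e4 := hproper _ _ tw.adj₁
    have e5 := hproper _ _ tw.adj₂
    -- If one end has type 0, the middle vertices take types 1 and 2, which forces type 0 at the
    -- other end. Then the edges to the two middle vertices agree in color at each end, so the
    -- middle vertices have the same type although adjacent.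
    have hw0 : vertexType c w = 0 := by omega
    rw [tx.vertexType_eq, tripleType_eq_zero_iff] at hx0
    rw [tw.vertexType_eq, tripleType_eq_zero_iff] at hw0
    refine e3 ?_
    rw [ty.vertexType_eq, tz.vertexType_eq, edgeOf_symm tx.adj₁, edgeOf_symm tx.adj₂,
      edgeOf_symm tw.adj₁, edgeOf_symm tw.adj₂, edgeOf_symm ty.adj₂, hx0.1, hw0.1]
  · obtain ⟨-, h2, h3, h4, h5, h6⟩ := h
    have e1 := hproper _ _ h2
    have e2 := hproper _ _ h3
    have e3 := hproper _ _ h4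
    have e4 := hproper _ _ h5
    have e5 := hproper _ _ h6
    have e6 := hproper _ _ hxw
    omega

theorem not_isOddCycleOfDiamonds (H : IsTriangleLeafGraph G) {k : ℕ}
    (hc : HasColorBlindColoring G k) : ¬ IsOddCycleOfDiamonds G := by
  rintro ⟨⟨_, hall⟩, t, ht, hcard⟩
  obtain ⟨c, hc⟩ := hc
  have hD := hc.isDiamondTypeColoring H hall
  have h1 := hD.even
  have h2 := hD.card_eq
  rw [Nat.even_iff] at h1
  rw [Nat.odd_iff] at ht
  omega

theorem hasColorBlindColoring_three (H : IsTriangleLeafGraph G) (hconn : G.Connected)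
    (hG : ¬ IsOddCycleOfDiamonds G) : HasColorBlindColoring G 3 := by
  obtain ⟨τ, hτ⟩ := exists_isTypeColoring H hconn hG
  obtain ⟨c, hc, _⟩ := hτ.exists_distinguishing H
  exact ⟨c, hc⟩

end Main

end ColorBlind

theorem theorem2 {V : Type*} [Fintype V] (G : SimpleGraph V) [DecidableRel G.Adj]
    (hconn : G.Connected) :
    -- cubic graphs in which every vertex is on a 3-cycle
    ((G.IsRegularOfDegree 3 ∧ ∀ v : V, ColorBlind.OnThreeCycle G v) →
      ((∃ k : ℕ, ColorBlind.HasColorBlindColoring G k) ↔ ¬ ColorBlind.IsOddCycleOfDiamonds G) ∧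
      (¬ ColorBlind.IsOddCycleOfDiamonds G → ColorBlind.dal G ≤ 3)) ∧
    -- the strengthening to {1,3}-regular graphs
    (((∀ v : V, G.degree v = 1 ∨ G.degree v = 3) ∧
        (∀ u v : V, G.Adj u v → G.degree u = 1 → G.degree v = 3) ∧
        (∀ v : V, G.degree v = 3 → ColorBlind.OnThreeCycle G v)) →
      (ColorBlind.HasColorBlindColoring G 3 ↔ ¬ ColorBlind.IsOddCycleOfDiamonds G) ∧
      (ColorBlind.HasColorBlindColoring G 3 →
        ∀ u v : V, G.Adj u v → G.degree u = 1 → G.degree v = 3 →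
          ∃ c₁ c₂ : G.EdgeLabeling (Fin 3),
            ColorBlind.IsColorBlindDistinguishing c₁ ∧
            ColorBlind.IsColorBlindDistinguishing c₂ ∧
            ColorBlind.colorBlindPartition c₁ v ≠ ColorBlind.colorBlindPartition c₂ v)) := by
  refine ⟨fun ⟨hreg, htri⟩ => ?_, fun ⟨hdeg, hleaf, htri⟩ => ?_⟩
  · have H : ColorBlind.IsTriangleLeafGraph G :=
      ⟨fun v => .inr (hreg v), fun _ v _ _ => hreg v, fun v _ => htri v⟩
    refine ⟨⟨fun ⟨k, hk⟩ => ColorBlind.not_isOddCycleOfDiamonds H hk,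
      fun hG => ⟨3, ColorBlind.hasColorBlindColoring_three H hconn hG⟩⟩, fun hG => ?_⟩
    exact iInf₂_le 3 (ColorBlind.hasColorBlindColoring_three H hconn hG)
  · have H : ColorBlind.IsTriangleLeafGraph G := ⟨hdeg, hleaf, htri⟩
    refine ⟨⟨ColorBlind.not_isOddCycleOfDiamonds H, ColorBlind.hasColorBlindColoring_three H hconn⟩,
      fun hc u v huv hu hv => ?_⟩
    obtain ⟨τ, hτ⟩ :=
      ColorBlind.exists_isTypeColoring H hconn (ColorBlind.not_isOddCycleOfDiamonds H hc)
    obtain ⟨τ', hτ', hne⟩ := ColorBlind.exists_isTypeColoring_ne H hτ huv hu hv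
    obtain ⟨c₁, h₁, h₁v⟩ := hτ.exists_distinguishing H
    obtain ⟨c₂, h₂, h₂v⟩ := hτ'.exists_distinguishing H
    refine ⟨c₁, c₂, h₁, h₂, ?_⟩
    rw [Ne, ColorBlind.colorBlindPartition_eq_iff_vertexType c₁ c₂ hv hv, h₁v v hv, h₂v v hv]
    exact hne.symm
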